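/- Let $0\le\gamma<1$, $\delta>0$, and let $a,b,c,d\in\mathbb R$ with $b,d>0$ and $a,c<0$. Put $\kappa_1=\frac1{\delta+\gamma}$, $\kappa_2=1-\gamma$, $\lambda=\frac{\delta^2-\gamma}{(\delta+\gamma)^2}$, $c'=(1-\gamma)c$. Denote by $\|\cdot\|$ and $(\cdot,\cdot)$ the norm and inner product of $L^2(0,1)$, by $\widehat g(k)=\int_0^1 g(x)e^{-2\pi i kx}\,dx$ the Fourier coefficients of a $1$-periodic function $g$, and by $H^\mu$ the periodic Sobolev space on $[0,1]$ with norm $\|g\|_\mu=\big(\sum_{k\in\mathbb Z}(1+k^2)^\mu|\widehat g(k)|^2\big)^{1/2}$. Let $T>0$, let $\mu\ge 1$ be real, and let $\zeta,u\in C^1([0,T];H^\mu)$ be real-valued and satisfy, in the sense of $1$-periodic distributions in $x$ for every $t\in[0,T]$, $$\zeta_t+\kappa_1u_x+\lambda(\zeta u)_x+au_{xxx}-b\zeta_{xxt}=0,\qquad u_t+\kappa_2\zeta_x+\lambda uu_x+c'\zeta_{xxx}-du_{xxt}=0,$$ with $\zeta(\cdot,0)=\zeta_0$, $u(\cdot,0)=u_0$.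 For an integer $N\ge1$ let $S_N=\mathrm{span}\{e^{2\pi ikx}: k\in\mathbb Z,\ -N\le k\le N\}$ and $P_Nv=\sum_{|k|\le N}\widehat v(k)e^{2\pi ikx}$. A spectral Galerkin semidiscrete solution on $[0,T]$ is a pair of real-valued $C^1$ maps $\zeta_N,u_N:[0,T]\to S_N$ with $\zeta_N(0)=P_N\zeta_0$, $u_N(0)=P_Nu_0$ such that for all $t\in[0,T]$ and all $\varphi,\chi\in S_N$ $$(\zeta_{Nt},\varphi)+\kappa_1(u_{Nx},\varphi)+\lambda((\zeta_Nu_N)_x,\varphi)+a(u_{Nxxx},\varphi)-b(\zeta_{Nxxt},\varphi)=0,$$ $$(u_{Nt},\chi)+\kappa_2(\zeta_{Nx},\chi)+\lambda(u_Nu_{Nx},\chi)+c'(\zeta_{Nxxx},\chi)-d(u_{Nxxt},\chi)=0.$$ Then there are a constant $C$ and an integer $N_0$, both independent of $N$, such that for every $N\ge 1$: there is at most one semidiscrete solution on $[0,T]$; there is one if $N\ge N_0$; and whenever it exists on $[0,T]$ (in particular for all $N\ge N_0$), $$\max_{0\le t\le T}\big(\|\zeta_N-\zeta\|+\|u_N-u\|\big)\le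 C\,N^{-\mu}.$$ -/

import Mathlib

open Set Filter Topology MeasureTheory
open scoped ContDiff ComplexConjugate

namespace BBGalerkin

/-! ### Periodic Sobolev spaces on `[0,1]` -/

/-- The `k`-th Fourier coefficient `∫₀¹ f(x) e^{-2πikx} dx` of a real function on `(0,1)`. -/
noncomputable def fhat (f : ℝ → ℝ) (k : ℤ) : ℂ :=
  fourierCoeffOn (zero_lt_one : (0 : ℝ) < 1) (fun x => (f x : ℂ)) k

/-- The norm of `L²(0,1)`. -/
noncomputable def l2Norm (f : ℝ → ℝ) : ℝ := Real.sqrt (∫ x in (0 : ℝ)..1, (f x) ^ 2)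

/-- Membership of a real, 1-periodic function in the periodic Sobolev space `H^μ`. -/
structure MemHs (μ : ℝ) (f : ℝ → ℝ) : Prop where
  periodic : Function.Periodic f 1
  memLp : MemLp f 2 (volume.restrict (Ioc (0 : ℝ) 1))
  summable : Summable fun k : ℤ => (1 + (k : ℝ) ^ 2) ^ μ * ‖fhat f k‖ ^ 2

/-- The norm `(∑_k (1 + k²)^μ |f̂(k)|²)^{1/2}` of `H^μ`. -/
noncomputable def hsNorm (μ : ℝ) (f : ℝ → ℝ) : ℝ :=
  Real.sqrt (∑' k : ℤ, (1 + (k : ℝ) ^ 2) ^ μ * ‖fhat f k‖ ^ 2)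

/-- `f ∈ C¹([0,T]; H^μ)` with time derivative `ft`: the difference quotients of `f` converge to
`ft` in the norm of `H^μ` (one-sidedly at the end points), and `ft` is continuous into `H^μ`.
Fields are written `f t x`. -/
structure IsC1Hs (μ T : ℝ) (f ft : ℝ → ℝ → ℝ) : Prop where
  mem : ∀ t ∈ Icc 0 T, MemHs μ (f t)
  mem_deriv : ∀ t ∈ Icc 0 T, MemHs μ (ft t)
  hasDeriv : ∀ t ∈ Icc 0 T,
    Tendsto (fun s => hsNorm μ (fun x => (s - t)⁻¹ * (f s x - f t x) - ft t x))
      (𝓝[Icc 0 T \ {t}] t) (𝓝 0)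
  cont : ∀ t ∈ Icc 0 T,
    Tendsto (fun s => hsNorm μ (fun x => ft s x - ft t x)) (𝓝[Icc 0 T] t) (𝓝 0)

/-! ### The Boussinesq/Boussinesq system -/

/-- Parameters of the system: density ratio `γ`, depth ratio `δ`, and `a, b, c, d`. -/
structure Params where
  (γ δ a b c d : ℝ)

namespace Params

noncomputable def κ₁ (p : Params) : ℝ := 1 / (p.δ + p.γ)

def κ₂ (p : Params) : ℝ := 1 - p.γ

noncomputable def lam (p : Params) : ℝ := (p.δ ^ 2 - p.γ) / (p.δ + p.γ) ^ 2

/-- The coefficient `c' = (1 - γ) c` of `ζ_xxx`. -/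
def c' (p : Params) : ℝ := (1 - p.γ) * p.c

end Params

/-- `(ζ, u)`, of class `C¹([0,T]; H^μ)` with time derivatives `(ζt, ut)`, solves the periodic
initial-value problem
`ζ_t + κ₁ u_x + λ (ζ u)_x + a u_xxx - b ζ_xxt = 0`,
`u_t + κ₂ ζ_x + λ u u_x + c' ζ_xxx - d u_xxt = 0`,
`ζ(0) = ζ₀`, `u(0) = u₀`.
The equations hold at every `t ∈ [0,T]` in the sense of 1-periodic distributions in `x`
(with `u u_x = (u²/2)_x`). -/
structure IsSolution (p : Params) (μ T : ℝ) (ζ₀ u₀ : ℝ → ℝ) (ζ ζt u ut : ℝ → ℝ → ℝ) : Prop where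
  c1_ζ : IsC1Hs μ T ζ ζt
  c1_u : IsC1Hs μ T u ut
  init_ζ : ζ 0 = ζ₀
  init_u : u 0 = u₀
  eq_ζ : ∀ t ∈ Icc 0 T, ∀ φ : ℝ → ℝ, ContDiff ℝ ∞ φ → Function.Periodic φ 1 →
    (∫ x in (0 : ℝ)..1, ζt t x * φ x)
      - p.κ₁ * (∫ x in (0 : ℝ)..1, u t x * deriv φ x)
      - p.lam * (∫ x in (0 : ℝ)..1, (ζ t x * u t x) * deriv φ x)
      - p.a * (∫ x in (0 : ℝ)..1, u t x * iteratedDeriv 3 φ x)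
      - p.b * (∫ x in (0 : ℝ)..1, ζt t x * iteratedDeriv 2 φ x) = 0
  eq_u : ∀ t ∈ Icc 0 T, ∀ φ : ℝ → ℝ, ContDiff ℝ ∞ φ → Function.Periodic φ 1 →
    (∫ x in (0 : ℝ)..1, ut t x * φ x)
      - p.κ₂ * (∫ x in (0 : ℝ)..1, ζ t x * deriv φ x)
      - p.lam * (∫ x in (0 : ℝ)..1, ((u t x) ^ 2 / 2) * deriv φ x)
      - p.c' * (∫ x in (0 : ℝ)..1, ζ t x * iteratedDeriv 3 φ x)
      - p.d * (∫ x in (0 : ℝ)..1, ut t x * iteratedDeriv 2 φ x) = 0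

/-! ### The spectral Galerkin semidiscretization -/

/-- The 1-periodic exponential `x ↦ e^{2πikx}`. -/
noncomputable def expo (k : ℤ) (x : ℝ) : ℂ := Complex.exp (2 * Real.pi * Complex.I * k * x)

/-- `S_N = span {e^{2πikx} : -N ≤ k ≤ N}`. -/
noncomputable def trigSpace (N : ℕ) : Submodule ℂ (ℝ → ℂ) :=
  Submodule.span ℂ {f | ∃ k : ℤ, -(N : ℤ) ≤ k ∧ k ≤ N ∧ f = expo k}

/-- The real function `f` belongs to `S_N`. -/
def RealMem (N : ℕ) (f : ℝ → ℝ) : Prop := (fun x => (f x : ℂ)) ∈ trigSpace N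

/-- The `L²`-projection `P_N v = ∑_{|k| ≤ N} v̂(k) e^{2πikx}` onto `S_N`. -/
noncomputable def proj (N : ℕ) (v : ℝ → ℝ) (x : ℝ) : ℂ :=
  ∑ k ∈ Finset.Icc (-(N : ℤ)) N, fhat v k * expo k x

/-- The inner product `(f, φ)` of `L²(0,1)`, for real `f`. -/
noncomputable def ip (f : ℝ → ℝ) (φ : ℝ → ℂ) : ℂ :=
  ∫ x in (0 : ℝ)..1, (f x : ℂ) * conj (φ x)

/-- `(ζN, uN)`, real-valued and of class `C¹` from `[0,T]` into `S_N`, with time derivatives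
`(ζNt, uNt)`, satisfies the semidiscrete problem on `[0,T]`. -/
structure SemidiscreteEqs (p : Params) (T : ℝ) (N : ℕ) (ζ₀ u₀ : ℝ → ℝ)
    (ζN ζNt uN uNt : ℝ → ℝ → ℝ) : Prop where
  mem_ζ : ∀ t ∈ Icc 0 T, RealMem N (ζN t)
  mem_u : ∀ t ∈ Icc 0 T, RealMem N (uN t)
  mem_ζt : ∀ t ∈ Icc 0 T, RealMem N (ζNt t)
  mem_ut : ∀ t ∈ Icc 0 T, RealMem N (uNt t)
  c1_ζ : IsC1Hs 0 T ζN ζNt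
  c1_u : IsC1Hs 0 T uN uNt
  init_ζ : ∀ x, (ζN 0 x : ℂ) = proj N ζ₀ x
  init_u : ∀ x, (uN 0 x : ℂ) = proj N u₀ x
  eq_ζ : ∀ t ∈ Icc 0 T, ∀ φ ∈ trigSpace N,
    ip (ζNt t) φ + p.κ₁ * ip (deriv (uN t)) φ
      + p.lam * ip (deriv (fun x => ζN t x * uN t x)) φ
      + p.a * ip (iteratedDeriv 3 (uN t)) φ
      - p.b * ip (iteratedDeriv 2 (ζNt t)) φ = 0
  eq_u : ∀ t ∈ Icc 0 T, ∀ χ ∈ trigSpace N,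
    ip (uNt t) χ + p.κ₂ * ip (deriv (ζN t)) χ
      + p.lam * ip (fun x => uN t x * deriv (uN t) x) χ
      + p.c' * ip (iteratedDeriv 3 (ζN t)) χ
      - p.d * ip (iteratedDeriv 2 (uNt t)) χ = 0

/-- `(ζN, uN)` is a spectral Galerkin semidiscrete solution on `[0,T]`. -/
def IsSemidiscrete (p : Params) (T : ℝ) (N : ℕ) (ζ₀ u₀ : ℝ → ℝ) (ζN uN : ℝ → ℝ → ℝ) : Prop :=
  ∃ ζNt uNt : ℝ → ℝ → ℝ, SemidiscreteEqs p T N ζ₀ u₀ ζN ζNt uN uNt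

end BBGalerkin

open scoped NNReal

namespace BBGalerkin

/-! ### Square-integrable functions and their Fourier coefficients -/

/-! Both problems become ODEs for Fourier coefficients. With w = 2πk, dividing by 1 + bw² and 1 +
dw² gives ζ̂' = -iw(α û + λ(1 + bw²)⁻¹ (ζu)^) and û' = -iw(β ζ̂ + λ(1 + dw²)⁻¹ (u²/2)^), where α, β
are values of `symbol`. The exact solution satisfies this for every k, the Galerkin solution for |k|
≤ N. Hence the two can be compared directly on |k| ≤ N (`SolvesModes`), without estimating a
consistency error.

The signs of the parameters keep α and β between positive constants (`exists_symbol_bounds`). For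
the errors e, h of the two components, ∑ (β|e|² + α|h|²) is therefore equivalent to the squared ℓ²
error, and in its time derivative the linear terms cancel (`mode_energy_le`). For the nonlinear
terms, each coefficient of a difference of products is bounded, uniformly in k, by L² norms alone
(`IsL2.norm_fhat_mul_sub_sq_le`), while w²/(1 + bw²)² is summable over k (`summable_smoothing`). So
L² bounds suffice: neither sup-norm bounds nor inverse inequalities enter. Frequencies beyond N
contribute O(N^(-2μ)) (`RealMem.l2sq_sub_le`), and Gronwall's inequality closes the estimate
(`exists_energy_bound`).

The Gronwall constant depends on an a priori L² bound for the Galerkin solution. A continuity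
argument supplies it for large N: while the squared error is at most 1 the bound holds, and then the
error is in fact below 1 (`IsSolution.exists_convergence_bound`). That lemma asks for the equations
only where the bound holds, so it also applies to a globally solvable cut-off problem and shows that
the cutoff never acts, which gives existence. Uniqueness is the same energy estimate without tails.
For the finitely many small N, uniqueness and boundedness on [0,T] let the constant be enlarged. -/

/-- Square integrability on `(0,1)`. -/
def IsL2 (f : ℝ → ℝ) : Prop := MemLp f 2 (volume.restrict (Ioc (0 : ℝ) 1))

/-- The square of the norm of `L²(0,1)`. -/
noncomputable def l2sq (f : ℝ → ℝ) : ℝ := ∫ x in (0 : ℝ)..1, (f x) ^ 2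

theorem l2sq_nonneg (f : ℝ → ℝ) : 0 ≤ l2sq f :=
  intervalIntegral.integral_nonneg zero_le_one fun _ _ => sq_nonneg _

theorem continuous_expo (k : ℤ) : Continuous (expo k) := by
  unfold expo; fun_prop

theorem conj_expo (k : ℤ) (x : ℝ) : conj (expo k x) = expo (-k) x := by
  simp only [expo, ← Complex.exp_conj]
  congr 1
  simp [Complex.conj_ofNat]

theorem norm_expo (k : ℤ) (x : ℝ) : ‖expo k x‖ = 1 := by
  have : expo k x = Complex.exp ((2 * Real.pi * k * x : ℝ) * Complex.I) := by
    unfold expo; congr 1; push_cast; ring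
  rw [this, Complex.norm_exp_ofReal_mul_I]

theorem expo_add (j k : ℤ) (x : ℝ) : expo (j + k) x = expo j x * expo k x := by
  simp only [expo, ← Complex.exp_add]
  congr 1; push_cast; ring

theorem fhat_eq (f : ℝ → ℝ) (k : ℤ) :
    fhat f k = ∫ x in (0 : ℝ)..1, (f x : ℂ) * conj (expo k x) := by
  rw [fhat, fourierCoeffOn_eq_integral]
  simp only [sub_zero, div_one, one_smul]
  refine intervalIntegral.integral_congr fun x _ => ?_
  simp only [smul_eq_mul]
  rw [conj_expo, mul_comm, fourier_coe_apply]
  simp only [expo]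
  congr 2
  push_cast; ring

theorem ip_expo (f : ℝ → ℝ) (k : ℤ) : ip f (expo k) = fhat f k := (fhat_eq f k).symm

theorem fhat_neg (f : ℝ → ℝ) (k : ℤ) : fhat f (-k) = conj (fhat f k) := by
  rw [fhat_eq, fhat_eq, intervalIntegral.integral_of_le zero_le_one,
    intervalIntegral.integral_of_le zero_le_one, ← integral_conj]
  simp [conj_expo]

theorem norm_fhat_le (f : ℝ → ℝ) (k : ℤ) : ‖fhat f k‖ ≤ ∫ x in (0 : ℝ)..1, |f x| := by
  rw [fhat_eq]
  refine (intervalIntegral.norm_integral_le_integral_norm zero_le_one).trans (le_of_eq ?_)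
  refine intervalIntegral.integral_congr fun x _ => ?_
  simp [norm_expo]

theorem intervalIntegrable_mul_expo {f : ℝ → ℝ} (hf : IntervalIntegrable f volume 0 1) (k : ℤ) :
    IntervalIntegrable (fun x => (f x : ℂ) * conj (expo k x)) volume 0 1 := by
  refine IntervalIntegrable.mul_continuousOn ⟨hf.1.ofReal, hf.2.ofReal⟩ ?_
  exact (Complex.continuous_conj.comp (continuous_expo k)).continuousOn

theorem fhat_add {f g : ℝ → ℝ} (hf : IntervalIntegrable f volume 0 1)
    (hg : IntervalIntegrable g volume 0 1) (k : ℤ) :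
    fhat (fun x => f x + g x) k = fhat f k + fhat g k := by
  simp only [fhat_eq]
  rw [← intervalIntegral.integral_add (intervalIntegrable_mul_expo hf k)
    (intervalIntegrable_mul_expo hg k)]
  refine intervalIntegral.integral_congr fun x _ => ?_
  push_cast; ring

theorem fhat_const_mul (c : ℝ) (f : ℝ → ℝ) (k : ℤ) :
    fhat (fun x => c * f x) k = c * fhat f k := by
  simp only [fhat_eq]
  rw [← intervalIntegral.integral_const_mul]
  refine intervalIntegral.integral_congr fun x _ => ?_
  push_cast; ring

theorem fhat_sub {f g : ℝ → ℝ} (hf : IntervalIntegrable f volume 0 1)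
    (hg : IntervalIntegrable g volume 0 1) (k : ℤ) :
    fhat (fun x => f x - g x) k = fhat f k - fhat g k := by
  have h := fhat_add hf (hg.const_mul (-1)) k
  rw [fhat_const_mul] at h
  simpa [sub_eq_add_neg] using h

namespace IsL2

variable {f g f' g' : ℝ → ℝ}

theorem add (hf : IsL2 f) (hg : IsL2 g) : IsL2 fun x => f x + g x := MemLp.add hf hg

theorem sub (hf : IsL2 f) (hg : IsL2 g) : IsL2 fun x => f x - g x := MemLp.sub hf hg

theorem const_mul (hf : IsL2 f) (c : ℝ) : IsL2 fun x => c * f x := MemLp.const_mul hf c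

theorem of_continuous (hf : Continuous f) : IsL2 f := by
  obtain ⟨C, hC⟩ := isCompact_Icc.exists_bound_of_continuousOn (s := Icc (0 : ℝ) 1) hf.continuousOn
  refine MemLp.of_bound hf.aestronglyMeasurable C ?_
  filter_upwards [ae_restrict_mem measurableSet_Ioc] with x hx
  exact hC x (Ioc_subset_Icc_self hx)

theorem intervalIntegrable (hf : IsL2 f) : IntervalIntegrable f volume 0 1 := by
  rw [intervalIntegrable_iff_integrableOn_Ioc_of_le zero_le_one]
  exact MemLp.integrable one_le_two hf

theorem mul (hf : IsL2 f) (hg : IsL2 g) :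
    IntervalIntegrable (fun x => f x * g x) volume 0 1 := by
  rw [intervalIntegrable_iff_integrableOn_Ioc_of_le zero_le_one]
  exact MemLp.integrable_mul hf hg

theorem sq (hf : IsL2 f) : IntervalIntegrable (fun x => f x ^ 2) volume 0 1 := by
  simpa [pow_two] using hf.mul hf

theorem hasSum_sq (hf : IsL2 f) : HasSum (fun k => ‖fhat f k‖ ^ 2) (l2sq f) := by
  have h := hasSum_sq_fourierCoeffOn (zero_lt_one : (0 : ℝ) < 1) (f := fun x => (f x : ℂ))
    (MemLp.ofReal hf)
  simpa [fhat, l2sq] using h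

/-- The quadratic s ↦ ∫ (s|g| - |f|)² is nonnegative, so its discriminant is not positive. -/
theorem sq_integral_abs_mul_le (hf : IsL2 f) (hg : IsL2 g) :
    (∫ x in (0 : ℝ)..1, |f x * g x|) ^ 2 ≤ l2sq f * l2sq g := by
  have key : ∀ s : ℝ, 0 ≤ l2sq g * (s * s)
      + (-2 * ∫ x in (0 : ℝ)..1, |f x * g x|) * s + l2sq f := by
    intro s
    have h0 : (0 : ℝ) ≤ ∫ x in (0 : ℝ)..1, (s * s * g x ^ 2 + (-2 * s) * |f x * g x| + f x ^ 2) := by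
      refine intervalIntegral.integral_nonneg zero_le_one fun x _ => ?_
      have : s * s * g x ^ 2 + (-2 * s) * |f x * g x| + f x ^ 2 = (s * |g x| - |f x|) ^ 2 := by
        rw [abs_mul, ← sq_abs (g x), ← sq_abs (f x)]; ring
      rw [this]; positivity
    rw [intervalIntegral.integral_add ((hg.sq.const_mul _).add ((hf.mul hg).abs.const_mul _)) hf.sq,
      intervalIntegral.integral_add (hg.sq.const_mul _) ((hf.mul hg).abs.const_mul _),
      intervalIntegral.integral_const_mul, intervalIntegral.integral_const_mul] at h0
    unfold l2sq
    linarith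
  have := discrim_le_zero key
  unfold discrim at this
  nlinarith

theorem l2sq_add_le (hf : IsL2 f) (hg : IsL2 g) :
    l2sq (fun x => f x + g x) ≤ 2 * l2sq f + 2 * l2sq g := by
  unfold l2sq
  rw [← intervalIntegral.integral_const_mul, ← intervalIntegral.integral_const_mul,
    ← intervalIntegral.integral_add (hf.sq.const_mul _) (hg.sq.const_mul _)]
  refine intervalIntegral.integral_mono_on zero_le_one (hf.add hg).sq
    ((hf.sq.const_mul _).add (hg.sq.const_mul _)) fun x _ => ?_
  nlinarith [sq_nonneg (f x - g x)]

/-- The Fourier coefficients of a product depend on the factors continuously in `L²`. -/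
theorem norm_fhat_mul_sub_sq_le (hf : IsL2 f) (hg : IsL2 g) (hf' : IsL2 f') (hg' : IsL2 g')
    (k : ℤ) :
    ‖fhat (fun x => f x * g x) k - fhat (fun x => f' x * g' x) k‖ ^ 2 ≤
      2 * (l2sq (fun x => f x - f' x) * l2sq g + l2sq f' * l2sq (fun x => g x - g' x)) := by
  rw [← fhat_sub (hf.mul hg) (hf'.mul hg')]
  have h1 := (hf.sub hf').sq_integral_abs_mul_le hg
  have h2 := hf'.sq_integral_abs_mul_le (hg.sub hg')
  have h3 : ‖fhat (fun x => f x * g x - f' x * g' x) k‖ ≤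
      (∫ x in (0 : ℝ)..1, |(f x - f' x) * g x|) + ∫ x in (0 : ℝ)..1, |f' x * (g x - g' x)| := by
    refine (norm_fhat_le _ k).trans ?_
    rw [← intervalIntegral.integral_add ((hf.sub hf').mul hg).abs (hf'.mul (hg.sub hg')).abs]
    refine intervalIntegral.integral_mono_on zero_le_one ((hf.mul hg).sub (hf'.mul hg')).abs
      (((hf.sub hf').mul hg).abs.add (hf'.mul (hg.sub hg')).abs) fun x _ => ?_
    have : f x * g x - f' x * g' x = (f x - f' x) * g x + f' x * (g x - g' x) := by ring
    rw [this]; exact abs_add_le _ _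
  have h4 := pow_le_pow_left₀ (norm_nonneg _) h3 2
  refine h4.trans (add_sq_le.trans ?_)
  gcongr

end IsL2

/-! ### Trigonometric polynomials -/

theorem hasDerivAt_expo (k : ℤ) (x : ℝ) :
    HasDerivAt (expo k) (2 * Real.pi * Complex.I * k * expo k x) x := by
  have h : HasDerivAt (fun y : ℝ => 2 * Real.pi * Complex.I * k * (y : ℂ))
      (2 * Real.pi * Complex.I * k) x := by
    simpa using (Complex.ofRealCLM.hasDerivAt (x := x)).const_mul (2 * Real.pi * Complex.I * k)
  have := h.cexp
  rw [mul_comm (Complex.exp _)] at this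
  exact this

theorem contDiff_expo (k : ℤ) : ContDiff ℝ ∞ (expo k) := by
  unfold expo
  exact (contDiff_const.mul Complex.ofRealCLM.contDiff).cexp

theorem expo_zero (x : ℝ) : expo 0 x = 1 := by simp [expo]

theorem expo_add_one (k : ℤ) (x : ℝ) : expo k (x + 1) = expo k x := by
  have : 2 * Real.pi * Complex.I * k * ((x + 1 : ℝ) : ℂ) =
      2 * Real.pi * Complex.I * k * x + k * (2 * Real.pi * Complex.I) := by
    push_cast; ring
  rw [expo, this, Complex.exp_add, Complex.exp_int_mul_two_pi_mul_I, mul_one, expo]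

theorem integral_expo (k : ℤ) : ∫ x in (0 : ℝ)..1, expo k x = if k = 0 then 1 else 0 := by
  split_ifs with h
  · subst h
    simp [expo_zero]
  · have hc : (2 * Real.pi * Complex.I * k : ℂ) ≠ 0 := by
      have : (k : ℂ) ≠ 0 := by exact_mod_cast h
      have := Complex.two_pi_I_ne_zero
      simp_all
    have h1 : ∫ x in (0 : ℝ)..1, 2 * Real.pi * Complex.I * k * expo k x = expo k 1 - expo k 0 :=
      intervalIntegral.integral_eq_sub_of_hasDerivAt (fun x _ => hasDerivAt_expo k x)
        ((continuous_const.mul (continuous_expo k)).intervalIntegrable _ _)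
    have h2 := expo_add_one k 0
    rw [zero_add] at h2
    rw [intervalIntegral.integral_const_mul, h2, sub_self] at h1
    exact (mul_eq_zero.mp h1).resolve_left hc

theorem integral_expo_mul_conj (j k : ℤ) :
    ∫ x in (0 : ℝ)..1, expo j x * conj (expo k x) = if j = k then 1 else 0 := by
  simp only [conj_expo, ← expo_add, integral_expo]
  congr 1
  simp [← sub_eq_add_neg, sub_eq_zero]

/-- The frequencies `-N ≤ k ≤ N`. -/
noncomputable abbrev freq (N : ℕ) : Finset ℤ := Finset.Icc (-(N : ℤ)) N

theorem neg_mem_freq {N : ℕ} {k : ℤ} : -k ∈ freq N ↔ k ∈ freq N := by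
  simp only [freq, Finset.mem_Icc]; omega

theorem mem_trigSpace_iff {N : ℕ} {g : ℝ → ℂ} :
    g ∈ trigSpace N ↔ ∃ c : ℤ → ℂ, g = fun x => ∑ k ∈ freq N, c k * expo k x := by
  constructor
  · intro hg
    induction hg using Submodule.span_induction with
    | mem g hg =>
      obtain ⟨k, h1, h2, rfl⟩ := hg
      refine ⟨fun j => if j = k then 1 else 0, ?_⟩
      funext x
      simp [freq, h1, h2]
    | zero => exact ⟨0, by funext x; simp⟩
    | add g h _ _ hg hh =>
      obtain ⟨c, rfl⟩ := hg
      obtain ⟨d, rfl⟩ := hh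
      refine ⟨c + d, ?_⟩
      funext x
      simp [add_mul, Finset.sum_add_distrib]
    | smul a g _ hg =>
      obtain ⟨c, rfl⟩ := hg
      refine ⟨a • c, ?_⟩
      funext x
      simp [Finset.mul_sum, mul_assoc]
  · rintro ⟨c, rfl⟩
    have : (fun x => ∑ k ∈ freq N, c k * expo k x) = ∑ k ∈ freq N, c k • expo k := by
      funext x; simp
    rw [this]
    refine Submodule.sum_mem _ fun k hk => Submodule.smul_mem _ _ (Submodule.subset_span ?_)
    rw [Finset.mem_Icc] at hk
    exact ⟨k, hk.1, hk.2, rfl⟩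

theorem expo_mem_trigSpace {N : ℕ} {k : ℤ} (hk : k ∈ freq N) : expo k ∈ trigSpace N := by
  rw [Finset.mem_Icc] at hk
  exact Submodule.subset_span ⟨k, hk.1, hk.2, rfl⟩

theorem fhat_of_eq_sum {N : ℕ} {f : ℝ → ℝ} {c : ℤ → ℂ}
    (hf : ∀ x, (f x : ℂ) = ∑ k ∈ freq N, c k * expo k x) (k : ℤ) :
    fhat f k = if k ∈ freq N then c k else 0 := by
  have h : ∀ x, (f x : ℂ) * conj (expo k x) =
      ∑ j ∈ freq N, c j * (expo j x * conj (expo k x)) := fun x => by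
    rw [hf, Finset.sum_mul]
    simp only [mul_assoc]
  rw [fhat_eq]
  simp only [h]
  rw [intervalIntegral.integral_finsetSum]
  · simp only [intervalIntegral.integral_const_mul, integral_expo_mul_conj]
    simp
  · intro j _
    exact (continuous_const.mul ((continuous_expo j).mul
      (Complex.continuous_conj.comp (continuous_expo k)))).intervalIntegrable _ _

namespace RealMem

variable {N : ℕ} {f g : ℝ → ℝ}

theorem eq_sum (hf : RealMem N f) (x : ℝ) : (f x : ℂ) = ∑ k ∈ freq N, fhat f k * expo k x := by
  obtain ⟨c, hc⟩ := mem_trigSpace_iff.mp hf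
  have hc' := fun x => congrFun hc x
  rw [hc']
  refine Finset.sum_congr rfl fun k hk => ?_
  rw [fhat_of_eq_sum hc', if_pos hk]

theorem fhat_eq_zero (hf : RealMem N f) {k : ℤ} (hk : k ∉ freq N) : fhat f k = 0 := by
  rw [fhat_of_eq_sum hf.eq_sum, if_neg hk]

theorem ext (hf : RealMem N f) (hg : RealMem N g)
    (h : ∀ k ∈ freq N, fhat f k = fhat g k) : f = g := by
  funext x
  have : (f x : ℂ) = g x := by
    rw [hf.eq_sum, hg.eq_sum]
    exact Finset.sum_congr rfl fun k hk => by rw [h k hk]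
  exact_mod_cast this

theorem contDiff (hf : RealMem N f) : ContDiff ℝ ∞ f := by
  have h : f = fun x => Complex.reCLM (∑ k ∈ freq N, fhat f k * expo k x) := by
    funext x
    rw [← hf.eq_sum]; simp
  rw [h]
  exact Complex.reCLM.contDiff.comp
    (ContDiff.sum fun k _ => contDiff_const.mul (contDiff_expo k))

theorem periodic (hf : RealMem N f) : Function.Periodic f 1 := by
  intro x
  have : (f (x + 1) : ℂ) = f x := by
    rw [hf.eq_sum, hf.eq_sum]
    simp only [expo_add_one]
  exact_mod_cast this

theorem isL2 (hf : RealMem N f) : IsL2 f := .of_continuous hf.contDiff.continuous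

theorem memHs (hf : RealMem N f) (μ : ℝ) : MemHs μ f where
  periodic := hf.periodic
  memLp := hf.isL2
  summable := summable_of_ne_finset_zero (s := freq N) fun k hk => by simp [hf.fhat_eq_zero hk]

end RealMem

/-- The real part of the trigonometric polynomial with coefficients `c`. -/
noncomputable def trigRe (N : ℕ) (c : ℤ → ℂ) (x : ℝ) : ℝ :=
  (∑ k ∈ freq N, c k * expo k x).re

/-- Conjugation sends the frequency k to -k, so taking the real part averages `c k` with `conj (c
(-k))`. -/
theorem trigRe_eq_sum (N : ℕ) (c : ℤ → ℂ) (x : ℝ) :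
    (trigRe N c x : ℂ) = ∑ k ∈ freq N, (c k + conj (c (-k))) / 2 * expo k x := by
  have h : ∑ k ∈ freq N, conj (c (-k)) * expo k x = ∑ k ∈ freq N, conj (c k) * expo (-k) x := by
    refine Finset.sum_nbij' (fun k => -k) (fun k => -k) ?_ ?_ ?_ ?_ ?_
    · intro k hk; exact neg_mem_freq.mpr hk
    · intro k hk; exact neg_mem_freq.mpr hk
    · simp
    · simp
    · simp
  rw [trigRe, Complex.re_eq_add_conj, map_sum]
  simp only [map_mul, conj_expo]
  rw [← h, ← Finset.sum_add_distrib, Finset.sum_div]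
  exact Finset.sum_congr rfl fun k _ => by ring

theorem realMem_trigRe (N : ℕ) (c : ℤ → ℂ) : RealMem N (trigRe N c) :=
  mem_trigSpace_iff.mpr ⟨_, funext (trigRe_eq_sum N c)⟩

theorem fhat_trigRe (N : ℕ) (c : ℤ → ℂ) {k : ℤ} (hk : k ∈ freq N) :
    fhat (trigRe N c) k = (c k + conj (c (-k))) / 2 := by
  rw [fhat_of_eq_sum (trigRe_eq_sum N c), if_pos hk]

/-! ### Fourier coefficients of derivatives -/

theorem periodic_deriv {f : ℝ → ℝ} (hf : Function.Periodic f 1) :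
    Function.Periodic (deriv f) 1 := by
  intro x
  have : f = fun y => f (y + 1) := funext fun y => (hf y).symm
  conv_rhs => rw [this]
  rw [deriv_comp_add_const]

theorem fhat_deriv {f : ℝ → ℝ} (hf : ContDiff ℝ 1 f) (hp : Function.Periodic f 1) (k : ℤ) :
    fhat (deriv f) k = 2 * Real.pi * Complex.I * k * fhat f k := by
  have hd : ∀ x, HasDerivAt (fun y => (f y : ℂ)) ((deriv f x : ℝ) : ℂ) x := fun x =>
    ((hf.differentiable one_ne_zero).differentiableAt.hasDerivAt (x := x)).ofReal_comp
  have hc : Continuous (fun x => ((deriv f x : ℝ) : ℂ)) :=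
    Complex.continuous_ofReal.comp (hf.continuous_deriv le_rfl)
  have h := intervalIntegral.integral_mul_deriv_eq_deriv_mul (a := 0) (b := 1)
    (u := fun y => (f y : ℂ)) (v := expo (-k)) (u' := fun x => ((deriv f x : ℝ) : ℂ))
    (v' := fun x => 2 * Real.pi * Complex.I * (-k : ℤ) * expo (-k) x)
    (fun x _ => hd x) (fun x _ => hasDerivAt_expo (-k) x)
    (hc.intervalIntegrable _ _)
    ((continuous_const.mul (continuous_expo (-k))).intervalIntegrable _ _)
  have h1 : f 1 = f 0 := by simpa using hp 0
  have h2 : expo (-k) 1 = expo (-k) 0 := by simpa using expo_add_one (-k) 0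
  rw [h1, h2, sub_self, zero_sub] at h
  simp only [fhat_eq, conj_expo]
  rw [← intervalIntegral.integral_const_mul, ← neg_eq_iff_eq_neg.mpr h,
    ← intervalIntegral.integral_neg]
  refine intervalIntegral.integral_congr fun x _ => ?_
  push_cast; ring

theorem fhat_iteratedDeriv {f : ℝ → ℝ} (hf : ContDiff ℝ ∞ f) (hp : Function.Periodic f 1)
    (n : ℕ) (k : ℤ) :
    fhat (iteratedDeriv n f) k = (2 * Real.pi * Complex.I * k) ^ n * fhat f k := by
  -- Periodicity is carried through the induction because each integration by parts needs it to
  -- cancel the boundary terms.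
  suffices H : Function.Periodic (iteratedDeriv n f) 1 ∧
      fhat (iteratedDeriv n f) k = (2 * Real.pi * Complex.I * k) ^ n * fhat f k from H.2
  induction n with
  | zero => simpa using hp
  | succ n ih =>
    rw [iteratedDeriv_succ]
    refine ⟨periodic_deriv ih.1, ?_⟩
    have hc : ContDiff ℝ 1 (iteratedDeriv n f) := by
      refine iteratedDeriv_eq_iterate (f := f) (n := n) ▸ (hf.iterate_deriv n).of_le ?_
      exact_mod_cast le_top
    rw [fhat_deriv hc ih.1, ih.2]
    ring

/-! ### The equations in terms of Fourier coefficients -/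

/-- The angular frequency `2πk`. -/
noncomputable def angular (k : ℤ) : ℝ := 2 * Real.pi * k

/-- The solution `A` of `(1 + b w²) A + i w ((κ - a w²) B + l Q) = 0` with `w = 2πk`. -/
noncomputable def modeRate (κ l a b : ℝ) (k : ℤ) (B Q : ℂ) : ℂ :=
  -(Complex.I * angular k) * ((κ - a * angular k ^ 2 : ℝ) * B + l * Q) /
    (1 + b * angular k ^ 2 : ℝ)

theorem one_add_mul_sq_pos {b : ℝ} (hb : 0 < b) (w : ℝ) : 0 < 1 + b * w ^ 2 := by positivity

/-- On the k-th mode 1 - b∂ₓ² is multiplication by 1 + bw² > 0, so the equation can be solved for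
the time derivative. -/
theorem eq_modeRate_iff {κ l a b : ℝ} (hb : 0 < b) {k : ℤ} {A B Q : ℂ} :
    A = modeRate κ l a b k B Q ↔
      A + κ * (2 * Real.pi * Complex.I * k * B) + l * (2 * Real.pi * Complex.I * k * Q)
        + a * ((2 * Real.pi * Complex.I * k) ^ 3 * B)
        - b * ((2 * Real.pi * Complex.I * k) ^ 2 * A) = 0 := by
  have h : ((1 + b * angular k ^ 2 : ℝ) : ℂ) ≠ 0 := by
    exact_mod_cast (one_add_mul_sq_pos hb _).ne'
  rw [modeRate, eq_div_iff h, ← sub_eq_zero]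
  have e3 : (2 * Real.pi * Complex.I * k : ℂ) ^ 3 = -(Complex.I * (2 * Real.pi * k) ^ 3) := by
    linear_combination ((2 * Real.pi * k) ^ 3 * Complex.I : ℂ) * Complex.I_sq
  have e2 : (2 * Real.pi * Complex.I * k : ℂ) ^ 2 = -(2 * Real.pi * k) ^ 2 := by
    linear_combination ((2 * Real.pi * k) ^ 2 : ℂ) * Complex.I_sq
  rw [e3, e2]
  unfold angular
  push_cast
  refine Eq.congr_left ?_
  ring

/-- The rates respect the symmetry v̂(-k) = conj v̂(k) of real functions, so the coefficient ODE
preserves reality. -/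
theorem modeRate_neg (κ l a b : ℝ) (k : ℤ) (B Q : ℂ) :
    modeRate κ l a b (-k) (conj B) (conj Q) = conj (modeRate κ l a b k B Q) := by
  simp [modeRate, angular, Complex.conj_ofNat]

theorem modeRate_sub (κ l a b : ℝ) (k : ℤ) (B Q B' Q' : ℂ) :
    modeRate κ l a b k B Q - modeRate κ l a b k B' Q' =
      modeRate κ l a b k (B - B') (Q - Q') := by
  unfold modeRate; ring

/-- A pair of functions with given time derivatives satisfies the `k`-th Fourier mode of the
system. -/
def ModeEq (p : Params) (k : ℤ) (f ft g gt : ℝ → ℝ) : Prop :=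
  fhat ft k = modeRate p.κ₁ p.lam p.a p.b k (fhat g k) (fhat (fun x => f x * g x) k) ∧
  fhat gt k = modeRate p.κ₂ p.lam p.c' p.d k (fhat f k) (fhat (fun x => g x ^ 2 / 2) k)

/-! ### Weak and Galerkin equations, mode by mode -/

/-- The distributional equations are tested with real functions only, so a complex coefficient is
assembled from its cosine and sine parts. -/
theorem fhat_eq_cos_sin {f : ℝ → ℝ} (hf : IntervalIntegrable f volume 0 1) (k : ℤ) :
    fhat f k = (∫ x in (0 : ℝ)..1, f x * Real.cos (angular k * x) : ℝ) -
      Complex.I * (∫ x in (0 : ℝ)..1, f x * Real.sin (angular k * x) : ℝ) := by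
  rw [fhat_eq, ← intervalIntegral.integral_ofReal, ← intervalIntegral.integral_ofReal,
    ← intervalIntegral.integral_const_mul, ← intervalIntegral.integral_sub]
  · refine intervalIntegral.integral_congr fun x _ => ?_
    have : conj (expo k x) = Complex.exp (((-(angular k * x) : ℝ) : ℂ) * Complex.I) := by
      rw [conj_expo, expo, angular]; congr 1; push_cast; ring
    simp only [this, Complex.exp_ofReal_mul_I]
    simp only [Real.cos_neg, Real.sin_neg]
    push_cast; ring
  · have := hf.mul_continuousOn (g := fun x => Real.cos (angular k * x)) (by fun_prop)
    exact ⟨this.1.ofReal, this.2.ofReal⟩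
  · have := hf.mul_continuousOn (g := fun x => Real.sin (angular k * x)) (by fun_prop)
    exact IntervalIntegrable.const_mul ⟨this.1.ofReal, this.2.ofReal⟩ _

theorem deriv_cos_mul (w : ℝ) :
    deriv (fun x => Real.cos (w * x)) = fun x => -w * Real.sin (w * x) := by
  funext x
  have h := ((hasDerivAt_id x).const_mul w).cos
  simp only [id] at h
  rw [h.deriv]; ring

theorem deriv_sin_mul (w : ℝ) :
    deriv (fun x => Real.sin (w * x)) = fun x => w * Real.cos (w * x) := by
  funext x
  have h := ((hasDerivAt_id x).const_mul w).sin
  simp only [id] at h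
  rw [h.deriv]; ring

theorem iteratedDeriv_two_cos_mul (w : ℝ) :
    iteratedDeriv 2 (fun x => Real.cos (w * x)) = fun x => -w ^ 2 * Real.cos (w * x) := by
  rw [iteratedDeriv_succ, iteratedDeriv_one, deriv_cos_mul, deriv_const_mul_field', deriv_sin_mul]
  funext x; simp; ring

theorem iteratedDeriv_two_sin_mul (w : ℝ) :
    iteratedDeriv 2 (fun x => Real.sin (w * x)) = fun x => -w ^ 2 * Real.sin (w * x) := by
  rw [iteratedDeriv_succ, iteratedDeriv_one, deriv_sin_mul, deriv_const_mul_field', deriv_cos_mul]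
  funext x; simp; ring

theorem iteratedDeriv_three_cos_mul (w : ℝ) :
    iteratedDeriv 3 (fun x => Real.cos (w * x)) = fun x => w ^ 3 * Real.sin (w * x) := by
  rw [iteratedDeriv_succ, iteratedDeriv_two_cos_mul, deriv_const_mul_field', deriv_cos_mul]
  funext x; simp; ring

theorem iteratedDeriv_three_sin_mul (w : ℝ) :
    iteratedDeriv 3 (fun x => Real.sin (w * x)) = fun x => -w ^ 3 * Real.cos (w * x) := by
  rw [iteratedDeriv_succ, iteratedDeriv_two_sin_mul, deriv_const_mul_field', deriv_sin_mul]
  funext x; simp; ring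

/-- A distributional equation on the circle, read off at the `k`-th Fourier mode. -/
theorem fhat_eq_modeRate_of_distrib {κ l a b : ℝ} (hb : 0 < b) {A B Q : ℝ → ℝ}
    (hA : IntervalIntegrable A volume 0 1) (hB : IntervalIntegrable B volume 0 1)
    (hQ : IntervalIntegrable Q volume 0 1)
    (h : ∀ φ : ℝ → ℝ, ContDiff ℝ ∞ φ → Function.Periodic φ 1 →
      (∫ x in (0 : ℝ)..1, A x * φ x) - κ * (∫ x in (0 : ℝ)..1, B x * deriv φ x)
        - l * (∫ x in (0 : ℝ)..1, Q x * deriv φ x)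
        - a * (∫ x in (0 : ℝ)..1, B x * iteratedDeriv 3 φ x)
        - b * (∫ x in (0 : ℝ)..1, A x * iteratedDeriv 2 φ x) = 0) (k : ℤ) :
    fhat A k = modeRate κ l a b k (fhat B k) (fhat Q k) := by
  have hper : ∀ x : ℝ, angular k * (x + 1) = angular k * x + k * (2 * Real.pi) := fun x => by
    unfold angular; ring
  -- The cosine identity minus i times the sine identity is the equation tested with e^{-2πikx}.
  have hc := h (fun x => Real.cos (angular k * x)) (by fun_prop)
    (fun x => by simp only [hper, Real.cos_add_int_mul_two_pi])
  have hs := h (fun x => Real.sin (angular k * x)) (by fun_prop)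
    (fun x => by simp only [hper, Real.sin_add_int_mul_two_pi])
  rw [deriv_cos_mul, iteratedDeriv_two_cos_mul, iteratedDeriv_three_cos_mul] at hc
  rw [deriv_sin_mul, iteratedDeriv_two_sin_mul, iteratedDeriv_three_sin_mul] at hs
  have pull : ∀ (F G : ℝ → ℝ) (r : ℝ),
      ∫ x in (0 : ℝ)..1, F x * (r * G x) = r * ∫ x in (0 : ℝ)..1, F x * G x := fun F G r => by
    rw [← intervalIntegral.integral_const_mul]
    exact intervalIntegral.integral_congr fun x _ => mul_left_comm _ _ _
  simp only [pull] at hc hs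
  rw [eq_modeRate_iff hb, fhat_eq_cos_sin hA, fhat_eq_cos_sin hB, fhat_eq_cos_sin hQ]
  have e : (2 * Real.pi * Complex.I * k : ℂ) = Complex.I * angular k := by
    unfold angular; push_cast; ring
  rw [e]
  generalize angular k = w at *
  have hc' := congrArg (fun r : ℝ => (r : ℂ)) hc
  have hs' := congrArg (fun r : ℝ => (r : ℂ)) hs
  push_cast at hc' hs' ⊢
  generalize (∫ x in (0 : ℝ)..1, A x * Real.cos (w * x)) = Ac at *
  generalize (∫ x in (0 : ℝ)..1, A x * Real.sin (w * x)) = As at *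
  generalize (∫ x in (0 : ℝ)..1, B x * Real.cos (w * x)) = Bc at *
  generalize (∫ x in (0 : ℝ)..1, B x * Real.sin (w * x)) = Bs at *
  generalize (∫ x in (0 : ℝ)..1, Q x * Real.cos (w * x)) = Qc at *
  generalize (∫ x in (0 : ℝ)..1, Q x * Real.sin (w * x)) = Qs at *
  have I2 := Complex.I_sq
  have I3 : Complex.I ^ 3 = -Complex.I := by linear_combination Complex.I * I2
  have I4 : Complex.I ^ 4 = 1 := by linear_combination (Complex.I ^ 2 - 1) * I2
  ring_nf at hc' hs' ⊢
  simp only [I2, I3, I4]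
  linear_combination hc' - Complex.I * hs'

theorem ip_sum {N : ℕ} (f : ℝ → ℝ) (hf : IntervalIntegrable f volume 0 1) (c : ℤ → ℂ) :
    ip f (fun x => ∑ k ∈ freq N, c k * expo k x) = ∑ k ∈ freq N, conj (c k) * fhat f k := by
  have h : ∀ x, (f x : ℂ) * conj (∑ k ∈ freq N, c k * expo k x) =
      ∑ k ∈ freq N, conj (c k) * (f x * conj (expo k x)) := fun x => by
    rw [map_sum, Finset.mul_sum]
    exact Finset.sum_congr rfl fun k _ => by rw [map_mul]; ring
  simp only [ip, h]
  rw [intervalIntegral.integral_finsetSum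
    fun k _ => (intervalIntegrable_mul_expo hf k).const_mul _]
  simp only [intervalIntegral.integral_const_mul, fhat_eq]

/-- A Galerkin equation is equivalent to the equation of each of its Fourier modes. -/
theorem galerkin_iff_modeRate {κ l a b : ℝ} (hb : 0 < b) {N : ℕ} {A B Q : ℝ → ℝ}
    (hA : RealMem N A) (hB : RealMem N B) (hQ : ContDiff ℝ ∞ Q) (hQp : Function.Periodic Q 1) :
    (∀ φ ∈ trigSpace N, ip A φ + κ * ip (deriv B) φ + l * ip (deriv Q) φ
        + a * ip (iteratedDeriv 3 B) φ - b * ip (iteratedDeriv 2 A) φ = 0) ↔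
      ∀ k ∈ freq N, fhat A k = modeRate κ l a b k (fhat B k) (fhat Q k) := by
  have hle : (1 : WithTop ℕ∞) ≤ ∞ := by exact_mod_cast le_top
  have hmode : ∀ k, fhat A k = modeRate κ l a b k (fhat B k) (fhat Q k) ↔
      fhat A k + κ * fhat (deriv B) k + l * fhat (deriv Q) k
        + a * fhat (iteratedDeriv 3 B) k - b * fhat (iteratedDeriv 2 A) k = 0 := fun k => by
    rw [eq_modeRate_iff hb, fhat_deriv (hB.contDiff.of_le hle) hB.periodic,
      fhat_deriv (hQ.of_le hle) hQp, fhat_iteratedDeriv hB.contDiff hB.periodic,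
      fhat_iteratedDeriv hA.contDiff hA.periodic]
  constructor
  · intro h k hk
    rw [hmode]
    simpa only [ip_expo] using h _ (expo_mem_trigSpace hk)
  · intro h φ hφ
    obtain ⟨c, rfl⟩ := mem_trigSpace_iff.mp hφ
    have hi : ∀ {F : ℝ → ℝ}, ContDiff ℝ ∞ F → ∀ n, IntervalIntegrable (iteratedDeriv n F) volume 0 1 :=
      fun hF n => (hF.continuous_iteratedDeriv n (by exact_mod_cast le_top)).intervalIntegrable _ _
    have hiB := hi hB.contDiff 1
    have hiQ := hi hQ 1
    rw [iteratedDeriv_one] at hiB hiQ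
    rw [ip_sum _ (hA.isL2.intervalIntegrable), ip_sum _ hiB, ip_sum _ hiQ,
      ip_sum _ (hi hB.contDiff 3), ip_sum _ (hi hA.contDiff 2)]
    simp only [Finset.mul_sum, ← Finset.sum_add_distrib, ← Finset.sum_sub_distrib]
    refine Finset.sum_eq_zero fun k hk => ?_
    have := (hmode k).mp (h k hk)
    linear_combination conj (c k) * this

theorem deriv_half_sq {f : ℝ → ℝ} (hf : Differentiable ℝ f) :
    deriv (fun x => f x ^ 2 / 2) = fun x => f x * deriv f x := by
  funext x
  have h := ((hf x).hasDerivAt.pow 2).div_const 2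
  refine HasDerivAt.deriv (h.congr_deriv ?_)
  ring

theorem IsSolution.modeEq {p : Params} {μ T : ℝ} {ζ₀ u₀ : ℝ → ℝ} {ζ ζt u ut : ℝ → ℝ → ℝ}
    (hsol : IsSolution p μ T ζ₀ u₀ ζ ζt u ut) (hb : 0 < p.b) (hd : 0 < p.d) {t : ℝ}
    (ht : t ∈ Icc 0 T) (k : ℤ) : ModeEq p k (ζ t) (ζt t) (u t) (ut t) := by
  have hζ : IsL2 (ζ t) := (hsol.c1_ζ.mem t ht).memLp
  have hζt : IsL2 (ζt t) := (hsol.c1_ζ.mem_deriv t ht).memLp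
  have hu : IsL2 (u t) := (hsol.c1_u.mem t ht).memLp
  have hut : IsL2 (ut t) := (hsol.c1_u.mem_deriv t ht).memLp
  exact ⟨fhat_eq_modeRate_of_distrib hb hζt.intervalIntegrable hu.intervalIntegrable
      (hζ.mul hu) (hsol.eq_ζ t ht) k,
    fhat_eq_modeRate_of_distrib hd hut.intervalIntegrable hζ.intervalIntegrable
      (hu.sq.div_const 2) (hsol.eq_u t ht) k⟩

/-- The semidiscrete equations at a fixed time are those of the Fourier modes `|k| ≤ N`. -/
theorem galerkin_iff_modeEq {p : Params} (hb : 0 < p.b) (hd : 0 < p.d) {N : ℕ}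
    {f ft g gt : ℝ → ℝ} (hf : RealMem N f) (hft : RealMem N ft) (hg : RealMem N g)
    (hgt : RealMem N gt) :
    ((∀ φ ∈ trigSpace N, ip ft φ + p.κ₁ * ip (deriv g) φ
        + p.lam * ip (deriv (fun x => f x * g x)) φ
        + p.a * ip (iteratedDeriv 3 g) φ - p.b * ip (iteratedDeriv 2 ft) φ = 0) ∧
      ∀ χ ∈ trigSpace N, ip gt χ + p.κ₂ * ip (deriv f) χ
        + p.lam * ip (fun x => g x * deriv g x) χ
        + p.c' * ip (iteratedDeriv 3 f) χ - p.d * ip (iteratedDeriv 2 gt) χ = 0) ↔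
      ∀ k ∈ freq N, ModeEq p k f ft g gt := by
  have h0 : Differentiable ℝ g := hg.contDiff.differentiable (by simp)
  have h1 := galerkin_iff_modeRate (κ := p.κ₁) (l := p.lam) (a := p.a) hb hft hg
    (hf.contDiff.mul hg.contDiff) (hf.periodic.mul hg.periodic)
  have h2 := galerkin_iff_modeRate (κ := p.κ₂) (l := p.lam) (a := p.c') hd hgt hf
    (Q := fun x => g x ^ 2 / 2)
    ((hg.contDiff.pow 2).div_const 2) (fun x => by simp only [hg.periodic x])
  rw [deriv_half_sq h0] at h2
  constructor
  · rintro ⟨e1, e2⟩ k hk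
    exact ⟨h1.mp e1 k hk, h2.mp e2 k hk⟩
  · intro h
    exact ⟨h1.mpr fun k hk => (h k hk).1, h2.mpr fun k hk => (h k hk).2⟩

/-! ### Periodic Sobolev norms -/

/-- The square of the norm of `H^μ`. -/
noncomputable def hsSq (μ : ℝ) (f : ℝ → ℝ) : ℝ :=
  ∑' k : ℤ, (1 + (k : ℝ) ^ 2) ^ μ * ‖fhat f k‖ ^ 2

theorem hsSq_nonneg (μ : ℝ) (f : ℝ → ℝ) : 0 ≤ hsSq μ f :=
  tsum_nonneg fun _ => by positivity

theorem hsNorm_sq (μ : ℝ) (f : ℝ → ℝ) : hsNorm μ f ^ 2 = hsSq μ f :=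
  Real.sq_sqrt (hsSq_nonneg μ f)

theorem hsNorm_nonneg (μ : ℝ) (f : ℝ → ℝ) : 0 ≤ hsNorm μ f := Real.sqrt_nonneg _

theorem norm_add_sq_le (z w : ℂ) : ‖z + w‖ ^ 2 ≤ 2 * (‖z‖ ^ 2 + ‖w‖ ^ 2) :=
  (pow_le_pow_left₀ (norm_nonneg _) (norm_add_le z w) 2).trans add_sq_le

theorem one_le_weight {μ : ℝ} (hμ : 0 ≤ μ) (k : ℤ) : 1 ≤ (1 + (k : ℝ) ^ 2) ^ μ :=
  Real.one_le_rpow (by nlinarith [sq_nonneg (k : ℝ)]) hμ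

namespace MemHs

variable {μ : ℝ} {f g : ℝ → ℝ}

theorem isL2 (hf : MemHs μ f) : IsL2 f := hf.memLp

theorem weight_add_le (hf : MemHs μ f) (hg : MemHs μ g) (k : ℤ) :
    (1 + (k : ℝ) ^ 2) ^ μ * ‖fhat (fun x => f x + g x) k‖ ^ 2 ≤
      2 * ((1 + (k : ℝ) ^ 2) ^ μ * ‖fhat f k‖ ^ 2) +
        2 * ((1 + (k : ℝ) ^ 2) ^ μ * ‖fhat g k‖ ^ 2) := by
  rw [fhat_add hf.isL2.intervalIntegrable hg.isL2.intervalIntegrable]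
  have h0 : 0 ≤ (1 + (k : ℝ) ^ 2) ^ μ := by positivity
  nlinarith [mul_le_mul_of_nonneg_left (norm_add_sq_le (fhat f k) (fhat g k)) h0]

theorem add (hf : MemHs μ f) (hg : MemHs μ g) : MemHs μ fun x => f x + g x where
  periodic := hf.periodic.add hg.periodic
  memLp := hf.isL2.add hg.isL2
  summable := Summable.of_nonneg_of_le (fun _ => by positivity) (weight_add_le hf hg)
    ((hf.summable.mul_left 2).add (hg.summable.mul_left 2))

theorem hsSq_add_le (hf : MemHs μ f) (hg : MemHs μ g) :
    hsSq μ (fun x => f x + g x) ≤ 2 * hsSq μ f + 2 * hsSq μ g := by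
  unfold hsSq
  rw [← tsum_mul_left, ← tsum_mul_left,
    ← (hf.summable.mul_left 2).tsum_add (hg.summable.mul_left 2)]
  exact (hf.add hg).summable.tsum_le_tsum (weight_add_le hf hg)
    ((hf.summable.mul_left 2).add (hg.summable.mul_left 2))

theorem weight_const_mul (c : ℝ) (f : ℝ → ℝ) (k : ℤ) :
    (1 + (k : ℝ) ^ 2) ^ μ * ‖fhat (fun x => c * f x) k‖ ^ 2 =
      c ^ 2 * ((1 + (k : ℝ) ^ 2) ^ μ * ‖fhat f k‖ ^ 2) := by
  rw [fhat_const_mul, norm_mul, mul_pow, Complex.norm_real, Real.norm_eq_abs, sq_abs]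
  ring

theorem const_mul (hf : MemHs μ f) (c : ℝ) : MemHs μ fun x => c * f x where
  periodic := fun x => by simp only [hf.periodic x]
  memLp := hf.isL2.const_mul c
  summable := by
    simp only [weight_const_mul]
    exact hf.summable.mul_left _

theorem hsSq_const_mul (c : ℝ) (f : ℝ → ℝ) : hsSq μ (fun x => c * f x) = c ^ 2 * hsSq μ f := by
  unfold hsSq
  simp only [weight_const_mul, tsum_mul_left]

theorem sub (hf : MemHs μ f) (hg : MemHs μ g) : MemHs μ fun x => f x - g x := by
  simpa [sub_eq_add_neg] using hf.add (hg.const_mul (-1))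

theorem norm_fhat_le (hμ : 0 ≤ μ) (hf : MemHs μ f) (k : ℤ) : ‖fhat f k‖ ≤ hsNorm μ f := by
  refine Real.le_sqrt_of_sq_le ?_
  refine le_trans ?_ (hf.summable.le_tsum k fun _ _ => by positivity)
  nlinarith [one_le_weight hμ k, sq_nonneg ‖fhat f k‖]

theorem l2sq_le_hsSq (hμ : 0 ≤ μ) (hf : MemHs μ f) : l2sq f ≤ hsSq μ f := by
  refine hasSum_le (fun k => ?_) hf.isL2.hasSum_sq hf.summable.hasSum
  nlinarith [one_le_weight hμ k, sq_nonneg ‖fhat f k‖]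

end MemHs

namespace IsC1Hs

variable {μ T : ℝ} {f ft : ℝ → ℝ → ℝ}

theorem memHs_quotient (h : IsC1Hs μ T f ft) {s t : ℝ} (hs : s ∈ Icc 0 T) (ht : t ∈ Icc 0 T) :
    MemHs μ fun x => (s - t)⁻¹ * (f s x - f t x) - ft t x :=
  (((h.mem s hs).sub (h.mem t ht)).const_mul _).sub (h.mem_deriv t ht)

/-- Each Fourier coefficient is a linear functional bounded by the `H^μ` norm, so it passes to the
limit in the difference quotient. -/
theorem hasDerivWithinAt_fhat (hμ : 0 ≤ μ) (h : IsC1Hs μ T f ft) (k : ℤ) {t : ℝ}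
    (ht : t ∈ Icc 0 T) :
    HasDerivWithinAt (fun s => fhat (f s) k) (fhat (ft t) k) (Icc 0 T) t := by
  rw [hasDerivWithinAt_iff_tendsto_slope, tendsto_iff_norm_sub_tendsto_zero]
  refine squeeze_zero' (Eventually.of_forall fun _ => norm_nonneg _) ?_ (h.hasDeriv t ht)
  filter_upwards [self_mem_nhdsWithin] with s hs
  refine le_trans (le_of_eq ?_) ((h.memHs_quotient hs.1 ht).norm_fhat_le hμ k)
  have hi := (h.mem s hs.1).isL2.sub (h.mem t ht).isL2
  rw [fhat_sub (hi.const_mul _).intervalIntegrable (h.mem_deriv t ht).isL2.intervalIntegrable,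
    fhat_const_mul, fhat_sub (h.mem s hs.1).isL2.intervalIntegrable
      (h.mem t ht).isL2.intervalIntegrable, slope_def_module]
  simp

/-- Near each t, writing f(s) = f(t) + (s - t)(quotient error + f_t(t)) with quotient error of norm
at most 1 bounds f(s); compactness of [0,T] makes the bound uniform. -/
theorem exists_hsSq_le (h : IsC1Hs μ T f ft) :
    ∃ M, ∀ t ∈ Icc 0 T, hsSq μ (f t) ≤ M := by
  suffices H : ∃ M, ∀ t ∈ Icc 0 T, t ∈ Icc 0 T → hsSq μ (f t) ≤ M from
    H.imp fun M hM t ht => hM t ht ht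
  refine isCompact_Icc.induction_on (p := fun S => ∃ M, ∀ t ∈ S, t ∈ Icc 0 T → hsSq μ (f t) ≤ M)
    ⟨0, by simp⟩ (fun S S' hS => fun ⟨M, hM⟩ => ⟨M, fun t ht => hM t (hS ht)⟩) ?_ ?_
  · rintro S S' ⟨M, hM⟩ ⟨M', hM'⟩
    refine ⟨max M M', fun t ht ht' => ?_⟩
    rcases ht with ht | ht
    · exact (hM t ht ht').trans (le_max_left _ _)
    · exact (hM' t ht ht').trans (le_max_right _ _)
  · intro t ht
    have hev := (h.hasDeriv t ht).eventually_le_const zero_lt_one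
    rw [eventually_nhdsWithin_iff] at hev
    refine ⟨_, mem_nhdsWithin_of_mem_nhds hev,
      hsSq μ (f t) + (2 * hsSq μ (f t) + 2 * (T ^ 2 * (2 * 1 + 2 * hsSq μ (ft t)))), ?_⟩
    intro s hs hsT
    have n1 := hsSq_nonneg μ (f t)
    have n2 := hsSq_nonneg μ (ft t)
    rcases eq_or_ne s t with rfl | hst
    · have : 0 ≤ T ^ 2 * (2 * 1 + 2 * hsSq μ (ft s)) := by positivity
      linarith
    · have hq := h.memHs_quotient hsT ht
      have hq1 : hsSq μ (fun x => (s - t)⁻¹ * (f s x - f t x) - ft t x) ≤ 1 := by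
        rw [← hsNorm_sq]
        exact pow_le_one₀ (hsNorm_nonneg _ _) (hs ⟨hsT, hst⟩)
      have e : f s = fun x => f t x +
          (s - t) * (((s - t)⁻¹ * (f s x - f t x) - ft t x) + ft t x) := by
        funext x
        have := sub_ne_zero.mpr hst
        field_simp
        ring
      have b1 := hq.hsSq_add_le (h.mem_deriv t ht)
      have b2 := (h.mem t ht).hsSq_add_le ((hq.add (h.mem_deriv t ht)).const_mul (s - t))
      rw [MemHs.hsSq_const_mul, ← e] at b2
      have b3 : (s - t) ^ 2 ≤ T ^ 2 := by
        refine sq_le_sq' ?_ ?_ <;> linarith [hsT.1, hsT.2, ht.1, ht.2]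
      have b4 : (s - t) ^ 2 * hsSq μ (fun x => (s - t)⁻¹ * (f s x - f t x) - ft t x + ft t x) ≤
          T ^ 2 * (2 * 1 + 2 * hsSq μ (ft t)) := by
        refine mul_le_mul b3 (b1.trans ?_) (hsSq_nonneg _ _) (sq_nonneg T)
        linarith
      linarith

end IsC1Hs

/-- The squared `ℓ²` distance of the Fourier coefficients with `|k| ≤ N`. -/
noncomputable def modeSq (N : ℕ) (f g : ℝ → ℝ) : ℝ := ∑ k ∈ freq N, ‖fhat f k - fhat g k‖ ^ 2

theorem modeSq_nonneg (N : ℕ) (f g : ℝ → ℝ) : 0 ≤ modeSq N f g :=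
  Finset.sum_nonneg fun _ _ => sq_nonneg _

/-- By Parseval the modes |k| ≤ N give `modeSq`. Beyond N only ĝ remains, and there 1 ≤ N^(-2μ) (1 +
k²)^μ. -/
theorem RealMem.l2sq_sub_le {N : ℕ} (hN : 1 ≤ N) {μ : ℝ} (hμ : 0 ≤ μ) {f g : ℝ → ℝ}
    (hf : RealMem N f) (hg : MemHs μ g) :
    l2sq (fun x => f x - g x) ≤ modeSq N f g + ((N : ℝ) ^ (-μ)) ^ 2 * hsSq μ g := by
  have h1 : HasSum (fun k => if k ∈ freq N then ‖fhat f k - fhat g k‖ ^ 2 else 0)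
      (modeSq N f g) := by
    have := hasSum_sum_of_ne_finset_zero (L := .unconditional ℤ) (s := freq N)
      (f := fun k => if k ∈ freq N then ‖fhat f k - fhat g k‖ ^ 2 else 0)
      fun k hk => if_neg hk
    rwa [Finset.sum_congr rfl fun k hk => if_pos hk] at this
  refine hasSum_le (fun k => ?_) (hf.isL2.sub hg.isL2).hasSum_sq
    (h1.add (hg.summable.hasSum.mul_left (((N : ℝ) ^ (-μ)) ^ 2)))
  rw [fhat_sub hf.isL2.intervalIntegrable hg.isL2.intervalIntegrable]
  split_ifs with hk
  · have : 0 ≤ ((N : ℝ) ^ (-μ)) ^ 2 * ((1 + (k : ℝ) ^ 2) ^ μ * ‖fhat g k‖ ^ 2) := by positivity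
    linarith
  · rw [hf.fhat_eq_zero hk, zero_sub, norm_neg, zero_add]
    have hN0 : (0 : ℝ) < N := by exact_mod_cast hN
    have hNk : (N : ℝ) ^ 2 ≤ 1 + (k : ℝ) ^ 2 := by
      have : (N : ℤ) ≤ |k| := by
        rw [Finset.mem_Icc, ← abs_le, not_le] at hk
        exact hk.le
      have h2 : (N : ℝ) ≤ |(k : ℝ)| := by exact_mod_cast this
      nlinarith [sq_abs (k : ℝ), abs_nonneg (k : ℝ)]
    have h3 : ((N : ℝ) ^ μ) ^ 2 ≤ (1 + (k : ℝ) ^ 2) ^ μ := by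
      rw [Real.rpow_pow_comm hN0.le]
      exact Real.rpow_le_rpow (sq_nonneg _) hNk hμ
    have h4 : 1 ≤ ((N : ℝ) ^ (-μ)) ^ 2 * (1 + (k : ℝ) ^ 2) ^ μ := by
      rw [Real.rpow_neg hN0.le, inv_pow]
      have : 0 < ((N : ℝ) ^ μ) ^ 2 := by positivity
      rw [inv_mul_eq_div, le_div_iff₀ this]
      linarith
    nlinarith [sq_nonneg ‖fhat g k‖]

/-! ### The energy estimate -/

/-- The symbol `(κ - a w²) / (1 + b w²)` with `w = 2πk`. -/
noncomputable def symbol (κ a b : ℝ) (k : ℤ) : ℝ :=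
  (κ - a * angular k ^ 2) / (1 + b * angular k ^ 2)

/-- The squared smoothing factor `w² / (1 + b w²)²` with `w = 2πk`. -/
noncomputable def smoothing (b : ℝ) (k : ℤ) : ℝ := angular k ^ 2 / (1 + b * angular k ^ 2) ^ 2

/-- The symbol is the convex combination of κ and -a/b with weights proportional to 1 and bw². -/
theorem exists_symbol_bounds {κ a b : ℝ} (hκ : 0 < κ) (ha : a < 0) (hb : 0 < b) :
    ∃ lo hi : ℝ, 0 < lo ∧ 0 < hi ∧ ∀ k, lo ≤ symbol κ a b k ∧ symbol κ a b k ≤ hi := by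
  have hab : 0 < -a / b := div_pos (by linarith) hb
  refine ⟨min κ (-a / b), κ + -a / b, lt_min hκ hab, by linarith, fun k => ?_⟩
  have hw := sq_nonneg (angular k)
  have hden := one_add_mul_sq_pos hb (angular k)
  have e : -a = -a / b * b := by field_simp
  constructor
  · rw [symbol, le_div_iff₀ hden]
    have h1 := min_le_left κ (-a / b)
    have h2 := min_le_right κ (-a / b)
    have h3 : min κ (-a / b) * b ≤ -a := by
      calc _ ≤ -a / b * b := by gcongr
        _ = -a := e.symm
    nlinarith
  · rw [symbol, div_le_iff₀ hden]
    have h4 : 0 ≤ κ * b * angular k ^ 2 := by positivity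
    have h5 : -a * angular k ^ 2 = -a / b * b * angular k ^ 2 := by rw [← e]
    nlinarith

theorem smoothing_nonneg (b : ℝ) (k : ℤ) : 0 ≤ smoothing b k := by
  unfold smoothing; positivity

/-- For k ≠ 0 the term is at most 1/(b²w²) ≤ 1/(b²k²). -/
theorem summable_smoothing {b : ℝ} (hb : 0 < b) : Summable (smoothing b) := by
  have hs : Summable fun k : ℤ => (1 / b ^ 2) * (1 / (k : ℝ) ^ 2) :=
    (Real.summable_one_div_int_pow.mpr one_lt_two).mul_left _
  refine Summable.of_nonneg_of_le (smoothing_nonneg b) (fun k => ?_) hs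
  rcases eq_or_ne k 0 with rfl | hk
  -- Both sides vanish at k = 0, the comparison term because division by zero gives 0.
  · simp [smoothing, angular]
  · have hk0 : (0 : ℝ) < (k : ℝ) ^ 2 := by positivity
    have hw : (k : ℝ) ^ 2 ≤ angular k ^ 2 := by
      rw [angular, mul_pow]
      have : 1 ≤ (2 * Real.pi) ^ 2 := by nlinarith [Real.pi_gt_three]
      nlinarith
    have hden := one_add_mul_sq_pos hb (angular k)
    rw [smoothing, one_div_mul_one_div, div_le_div_iff₀ (by positivity) (by positivity)]
    have h1 : (b * angular k ^ 2) ^ 2 ≤ (1 + b * angular k ^ 2) ^ 2 := by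
      gcongr; linarith
    nlinarith [mul_le_mul_of_nonneg_left hw (by positivity : 0 ≤ b ^ 2 * angular k ^ 2)]

theorem modeRate_eq (κ l a b : ℝ) (k : ℤ) (B Q : ℂ) :
    modeRate κ l a b k B Q = (angular k * symbol κ a b k : ℝ) * -(Complex.I * B) +
      (l * (angular k / (1 + b * angular k ^ 2)) : ℝ) * -(Complex.I * Q) := by
  unfold modeRate symbol
  push_cast
  ring

theorem two_mul_inner_le (x : ℝ) (z w : ℂ) :
    2 * inner ℝ z ((x : ℂ) * -(Complex.I * w)) ≤ ‖z‖ ^ 2 + x ^ 2 * ‖w‖ ^ 2 := by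
  have h1 := real_inner_le_norm z ((x : ℂ) * -(Complex.I * w))
  have h2 : ‖(x : ℂ) * -(Complex.I * w)‖ ^ 2 = x ^ 2 * ‖w‖ ^ 2 := by simp [mul_pow]
  nlinarith [two_mul_le_add_sq ‖z‖ ‖(x : ℂ) * -(Complex.I * w)‖]

/-- Multiplication by i is skew-adjoint for the real inner product on ℂ; this is what removes the
linear part from the energy. -/
theorem inner_I_mul_add_inner_I_mul (z w : ℂ) :
    inner ℝ z (-(Complex.I * w)) + inner ℝ w (-(Complex.I * z)) = 0 := by
  simp [Complex.inner]; ring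

/-- The symmetrized linear part drops out of the energy of one Fourier mode. -/
theorem mode_energy_le {κ κ' l a b c d hi : ℝ} {k : ℤ} {e h q r : ℂ}
    (hα : 0 ≤ symbol κ a b k) (hα' : symbol κ a b k ≤ hi)
    (hβ : 0 ≤ symbol κ' c d k) (hβ' : symbol κ' c d k ≤ hi) :
    symbol κ' c d k * (2 * inner ℝ e (modeRate κ l a b k h q)) +
      symbol κ a b k * (2 * inner ℝ h (modeRate κ' l c d k e r)) ≤
      (symbol κ' c d k * ‖e‖ ^ 2 + symbol κ a b k * ‖h‖ ^ 2) +
        l ^ 2 * hi * (smoothing b k * ‖q‖ ^ 2 + smoothing d k * ‖r‖ ^ 2) := by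
  have h1 := two_mul_inner_le (l * (angular k / (1 + b * angular k ^ 2))) e q
  have h2 := two_mul_inner_le (l * (angular k / (1 + d * angular k ^ 2))) h r
  have h3 := inner_I_mul_add_inner_I_mul e h
  rw [mul_pow, div_pow] at h1 h2
  change _ ≤ _ + l ^ 2 * smoothing b k * _ at h1
  change _ ≤ _ + l ^ 2 * smoothing d k * _ at h2
  rw [modeRate_eq, modeRate_eq, inner_add_right, inner_add_right]
  have e1 : ∀ (x : ℝ) (z w : ℂ), inner ℝ z ((x : ℂ) * w) = x * inner ℝ z w := fun x z w => by
    rw [← Complex.real_smul, real_inner_smul_right]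
  rw [e1 (angular k * symbol κ a b k), e1 (angular k * symbol κ' c d k)]
  set α := symbol κ a b k
  set β := symbol κ' c d k
  have p1 := mul_le_mul_of_nonneg_left h1 hβ
  have p2 := mul_le_mul_of_nonneg_left h2 hα
  have n1 : 0 ≤ l ^ 2 * smoothing b k * ‖q‖ ^ 2 := by have := smoothing_nonneg b k; positivity
  have n2 : 0 ≤ l ^ 2 * smoothing d k * ‖r‖ ^ 2 := by have := smoothing_nonneg d k; positivity
  have p3 := mul_le_mul_of_nonneg_right hβ' n1
  have p4 := mul_le_mul_of_nonneg_right hα' n2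
  -- After weighting, the linear terms of both equations carry the same factor 2αβw, so `h3` cancels
  -- them.
  linear_combination p1 + p2 + p3 + p4 + 2 * α * β * angular k * h3

theorem fhat_half_sq (g : ℝ → ℝ) (k : ℤ) :
    fhat (fun x => g x ^ 2 / 2) k = (1 / 2 : ℝ) * fhat (fun x => g x * g x) k := by
  rw [← fhat_const_mul]
  congr 1
  funext x; ring

/-- The pair `(f, g)` with time derivatives `(ft, gt)` satisfies the equations of the Fourier modes
`|k| ≤ N` on `[0,τ]`. -/
structure SolvesModes (p : Params) (N : ℕ) (τ : ℝ) (f ft g gt : ℝ → ℝ → ℝ) : Prop where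
  isL2_left : ∀ t ∈ Icc 0 τ, IsL2 (f t)
  isL2_right : ∀ t ∈ Icc 0 τ, IsL2 (g t)
  deriv_left : ∀ k ∈ freq N, ∀ t ∈ Icc 0 τ,
    HasDerivWithinAt (fun s => fhat (f s) k) (fhat (ft t) k) (Icc 0 τ) t
  deriv_right : ∀ k ∈ freq N, ∀ t ∈ Icc 0 τ,
    HasDerivWithinAt (fun s => fhat (g s) k) (fhat (gt t) k) (Icc 0 τ) t
  modeEq : ∀ t ∈ Icc 0 τ, ∀ k ∈ freq N, ModeEq p k (f t) (ft t) (g t) (gt t)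

/-- The nonlinear coefficients are only bounded uniformly in k; summability comes entirely from the
smoothing factor, hence a bound independent of the frequency set. -/
theorem sum_smoothing_mul_le {b X : ℝ} (hb : 0 < b) (hX : 0 ≤ X) (s : Finset ℤ) {F : ℤ → ℝ}
    (hF : ∀ k, F k ≤ X) : ∑ k ∈ s, smoothing b k * F k ≤ (∑' k, smoothing b k) * X := by
  calc ∑ k ∈ s, smoothing b k * F k ≤ ∑ k ∈ s, smoothing b k * X :=
        Finset.sum_le_sum fun k _ => mul_le_mul_of_nonneg_left (hF k) (smoothing_nonneg b k)
    _ = (∑ k ∈ s, smoothing b k) * X := (Finset.sum_mul _ _ _).symm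
    _ ≤ _ := mul_le_mul_of_nonneg_right
        ((summable_smoothing hb).sum_le_tsum s fun k _ => smoothing_nonneg b k) hX

/-- Gronwall for the weighted energy `D`. The constant depends only on the parameters, `M` and `T`,
while `ε` measures what the modes |k| ≤ N do not see. Taking ε = 0 gives uniqueness, and ε of order
N^(-2μ) gives convergence. -/
theorem exists_energy_bound {p : Params} (hγ₀ : 0 ≤ p.γ) (hγ₁ : p.γ < 1) (hδ : 0 < p.δ)
    (hb : 0 < p.b) (hd : 0 < p.d) (ha : p.a < 0) (hc : p.c < 0) {M T : ℝ} (hM : 0 ≤ M) :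
    ∃ K : ℝ, 0 ≤ K ∧ ∀ (N : ℕ) (τ ε : ℝ) (f ft g gt f' ft' g' gt' : ℝ → ℝ → ℝ),
      τ ≤ T → 0 ≤ ε → SolvesModes p N τ f ft g gt → SolvesModes p N τ f' ft' g' gt' →
      (∀ t ∈ Icc 0 τ, l2sq (g t) ≤ M ∧ l2sq (f' t) ≤ M ∧ l2sq (g' t) ≤ M) →
      (∀ t ∈ Icc 0 τ, l2sq (fun x => f t x - f' t x) ≤ modeSq N (f t) (f' t) + ε ∧
        l2sq (fun x => g t x - g' t x) ≤ modeSq N (g t) (g' t) + ε) →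
      (∀ k ∈ freq N, fhat (f 0) k = fhat (f' 0) k) →
      (∀ k ∈ freq N, fhat (g 0) k = fhat (g' 0) k) →
      ∀ t ∈ Icc 0 τ, modeSq N (f t) (f' t) + modeSq N (g t) (g' t) ≤ K * ε := by
  have hκ₁ : 0 < p.κ₁ := by unfold Params.κ₁; positivity
  have hκ₂ : 0 < p.κ₂ := by unfold Params.κ₂; linarith
  have hc' : p.c' < 0 := mul_neg_of_pos_of_neg (by linarith) hc
  obtain ⟨lo₁, hi₁, hlo₁, hhi₁, hα⟩ := exists_symbol_bounds hκ₁ ha hb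
  obtain ⟨lo₂, hi₂, hlo₂, hhi₂, hβ⟩ := exists_symbol_bounds hκ₂ hc' hd
  set lo := min lo₁ lo₂
  set hi := max hi₁ hi₂
  have hlo : 0 < lo := lt_min hlo₁ hlo₂
  have hhi : 0 < hi := hhi₁.trans_le (le_max_left _ _)
  set α := symbol p.κ₁ p.a p.b
  set β := symbol p.κ₂ p.c' p.d
  have hα1 : ∀ k, lo ≤ α k := fun k => (min_le_left _ _).trans (hα k).1
  have hα2 : ∀ k, α k ≤ hi := fun k => (hα k).2.trans (le_max_left _ _)
  have hβ1 : ∀ k, lo ≤ β k := fun k => (min_le_right _ _).trans (hβ k).1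
  have hβ2 : ∀ k, β k ≤ hi := fun k => (hβ k).2.trans (le_max_right _ _)
  set S := (∑' k, smoothing p.b k) + ∑' k, smoothing p.d k with hS_def
  have hS : 0 ≤ S := add_nonneg (tsum_nonneg (smoothing_nonneg _)) (tsum_nonneg (smoothing_nonneg _))
  set L := p.lam ^ 2 * hi * S * (2 * M) with hL_def
  have hL : 0 ≤ L := by positivity
  -- The 1 comes from Young's inequality in each mode; `L / lo` comes from the nonlinearity, as `lo`
  -- times the squared mode error is at most `D`.
  set K₁ := 1 + L / lo with hK₁_def
  have hK₁ : 0 < K₁ := by positivity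
  refine ⟨2 * L / K₁ * Real.exp (K₁ * T) / lo, by positivity, ?_⟩
  intro N τ ε f ft g gt f' ft' g' gt' hτ hε hs hs' hbd htail h0f h0g
  set e : ℤ → ℝ → ℂ := fun k t => fhat (f t) k - fhat (f' t) k with he_def
  set h : ℤ → ℝ → ℂ := fun k t => fhat (g t) k - fhat (g' t) k with hh_def
  set D : ℝ → ℝ := fun t => ∑ k ∈ freq N, (β k * ‖e k t‖ ^ 2 + α k * ‖h k t‖ ^ 2)
  set D' : ℝ → ℝ := fun t => ∑ k ∈ freq N,
    (β k * (2 * inner ℝ (e k t) (fhat (ft t) k - fhat (ft' t) k)) +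
      α k * (2 * inner ℝ (h k t) (fhat (gt t) k - fhat (gt' t) k)))
  have hmode : ∀ t, lo * (modeSq N (f t) (f' t) + modeSq N (g t) (g' t)) ≤ D t := fun t => by
    rw [modeSq, modeSq, ← Finset.sum_add_distrib, Finset.mul_sum]
    refine Finset.sum_le_sum fun k _ => ?_
    rw [mul_add]
    exact add_le_add (mul_le_mul_of_nonneg_right (hβ1 k) (sq_nonneg _))
      (mul_le_mul_of_nonneg_right (hα1 k) (sq_nonneg _))
  have hderiv : ∀ t ∈ Icc 0 τ, HasDerivWithinAt D (D' t) (Icc 0 τ) t := fun t ht => by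
    refine HasDerivWithinAt.fun_sum fun k hk => ?_
    exact (((hs.deriv_left k hk t ht).sub (hs'.deriv_left k hk t ht)).norm_sq.const_mul _).add
      (((hs.deriv_right k hk t ht).sub (hs'.deriv_right k hk t ht)).norm_sq.const_mul _)
  have hbound : ∀ t ∈ Icc 0 τ, D' t ≤ K₁ * D t + 2 * L * ε := fun t ht => by
    obtain ⟨m1, m2, m3⟩ := hbd t ht
    obtain ⟨t1, t2⟩ := htail t ht
    -- One bound serving every coefficient of both nonlinear differences.
    set X := 2 * M * (l2sq (fun x => f t x - f' t x) + l2sq (fun x => g t x - g' t x)) with hX_def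
    have z1 := l2sq_nonneg (fun x => f t x - f' t x)
    have z2 := l2sq_nonneg (fun x => g t x - g' t x)
    have hX : 0 ≤ X := by positivity
    have hq : ∀ k, ‖fhat (fun x => f t x * g t x) k - fhat (fun x => f' t x * g' t x) k‖ ^ 2 ≤ X :=
      fun k => ((hs.isL2_left t ht).norm_fhat_mul_sub_sq_le (hs.isL2_right t ht)
        (hs'.isL2_left t ht) (hs'.isL2_right t ht) k).trans (by
          nlinarith [mul_le_mul_of_nonneg_left m1 z1, mul_le_mul_of_nonneg_right m2 z2])
    have hr : ∀ k, ‖fhat (fun x => g t x ^ 2 / 2) k - fhat (fun x => g' t x ^ 2 / 2) k‖ ^ 2 ≤ X :=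
      fun k => by
        rw [fhat_half_sq, fhat_half_sq, ← mul_sub, norm_mul, mul_pow, Complex.norm_real]
        have := (hs.isL2_right t ht).norm_fhat_mul_sub_sq_le (hs.isL2_right t ht)
          (hs'.isL2_right t ht) (hs'.isL2_right t ht) k
        norm_num
        nlinarith [mul_le_mul_of_nonneg_left m1 z2, mul_le_mul_of_nonneg_right m3 z2,
          mul_nonneg hM z1]
    have hstep : D' t ≤ D t + p.lam ^ 2 * hi * (S * X) := by
      calc D' t ≤ ∑ k ∈ freq N, ((β k * ‖e k t‖ ^ 2 + α k * ‖h k t‖ ^ 2) + p.lam ^ 2 * hi *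
            (smoothing p.b k *
                ‖fhat (fun x => f t x * g t x) k - fhat (fun x => f' t x * g' t x) k‖ ^ 2 +
              smoothing p.d k *
                ‖fhat (fun x => g t x ^ 2 / 2) k - fhat (fun x => g' t x ^ 2 / 2) k‖ ^ 2)) := by
            refine Finset.sum_le_sum fun k hk => ?_
            rw [(hs.modeEq t ht k hk).1, (hs.modeEq t ht k hk).2, (hs'.modeEq t ht k hk).1,
              (hs'.modeEq t ht k hk).2, modeRate_sub, modeRate_sub]
            exact mode_energy_le (hlo.le.trans (hα1 k)) (hα2 k) (hlo.le.trans (hβ1 k)) (hβ2 k)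
        _ ≤ D t + p.lam ^ 2 * hi * (S * X) := by
            rw [Finset.sum_add_distrib, ← Finset.mul_sum, hS_def, add_mul]
            refine add_le_add le_rfl (mul_le_mul_of_nonneg_left ?_ (by positivity))
            rw [Finset.sum_add_distrib]
            exact add_le_add (sum_smoothing_mul_le hb hX _ hq) (sum_smoothing_mul_le hd hX _ hr)
    have hX2 : X ≤ 2 * M * (D t / lo + 2 * ε) := by
      have : modeSq N (f t) (f' t) + modeSq N (g t) (g' t) ≤ D t / lo := by
        rw [le_div_iff₀ hlo, mul_comm]; exact hmode t
      rw [hX_def]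
      refine mul_le_mul_of_nonneg_left ?_ (by positivity)
      linarith
    have hlast : p.lam ^ 2 * hi * (S * X) ≤ L * (D t / lo + 2 * ε) := by
      calc p.lam ^ 2 * hi * (S * X) ≤ p.lam ^ 2 * hi * (S * (2 * M * (D t / lo + 2 * ε))) := by
            gcongr
        _ = _ := by rw [hL_def]; ring
    have : K₁ * D t + 2 * L * ε = D t + L * (D t / lo + 2 * ε) := by rw [hK₁_def]; ring
    linarith
  have hD0 : D 0 = 0 := Finset.sum_eq_zero fun k hk => by
    simp only [he_def, hh_def, h0f k hk, h0g k hk, sub_self]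
    simp
  have hgron := le_gronwallBound_of_liminf_deriv_right_le (f := D) (f' := D') (δ := 0) (K := K₁)
    (ε := 2 * L * ε) (a := 0) (b := τ) (fun t ht => (hderiv t ht).continuousWithinAt)
    (fun t ht r hr => by
      -- Gronwall's inequality wants a right derivative; at t < τ the interval [0,τ] contains a
      -- right neighbourhood of t.
      have h1 : HasDerivWithinAt D (D' t) (Ici t) t :=
        (hderiv t (Ico_subset_Icc_self ht)).mono_of_mem_nhdsWithin
          (mem_of_superset (Icc_mem_nhdsGE ht.2) (Icc_subset_Icc_left ht.1))
      simpa [slope_def_field, div_eq_inv_mul] using h1.liminf_right_slope_le hr)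
    hD0.le (fun t ht => hbound t (Ico_subset_Icc_self ht))
  intro t ht
  have h1 := hgron t ht
  rw [gronwallBound_of_K_ne_0 hK₁.ne'] at h1
  simp only [zero_mul, zero_add, sub_zero] at h1
  have h2 : Real.exp (K₁ * t) - 1 ≤ Real.exp (K₁ * T) := by
    have : Real.exp (K₁ * t) ≤ Real.exp (K₁ * T) :=
      Real.exp_le_exp.mpr (mul_le_mul_of_nonneg_left (ht.2.trans hτ) hK₁.le)
    linarith
  have h3 : lo * (modeSq N (f t) (f' t) + modeSq N (g t) (g' t)) ≤
      2 * L * ε / K₁ * Real.exp (K₁ * T) :=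
    (hmode t).trans (h1.trans (mul_le_mul_of_nonneg_left h2 (by positivity)))
  calc _ ≤ 2 * L * ε / K₁ * Real.exp (K₁ * T) / lo := by
        rw [le_div_iff₀ hlo, mul_comm]; exact h3
    _ = _ := by ring

/-! ### Uniqueness and convergence -/

/-- At the first time with y ≥ 1, the intermediate value theorem gives y = 1 there and y ≤ 1 before,
so `hstep` yields a contradiction. -/
theorem le_one_of_bootstrap {y : ℝ → ℝ} {T : ℝ} (hy : ContinuousOn y (Icc 0 T)) (h0 : y 0 < 1)
    (hstep : ∀ τ ∈ Icc 0 T, (∀ s ∈ Icc 0 τ, y s ≤ 1) → y τ < 1) :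
    ∀ t ∈ Icc 0 T, y t < 1 := by
  by_contra! hcon
  obtain ⟨t, ht, hty⟩ := hcon
  have hcomp : IsCompact (Icc 0 T ∩ y ⁻¹' Ici 1) :=
    isCompact_Icc.of_isClosed_subset (hy.preimage_isClosed_of_isClosed isClosed_Icc isClosed_Ici)
      inter_subset_left
  obtain ⟨t₀, ⟨ht₀, hy₀⟩, hmin⟩ := hcomp.exists_isLeast ⟨t, ht, hty⟩
  have hlt : ∀ s ∈ Icc 0 T, 1 ≤ y s → t₀ ≤ s := fun s hs h1 => hmin ⟨hs, h1⟩
  obtain ⟨s, hs, hs1⟩ := intermediate_value_Icc ht₀.1 (hy.mono (Icc_subset_Icc_right ht₀.2))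
    (show (1 : ℝ) ∈ Icc (y 0) (y t₀) from ⟨h0.le, hy₀⟩)
  have hst : s = t₀ := le_antisymm hs.2 (hlt s ⟨hs.1, hs.2.trans ht₀.2⟩ hs1.ge)
  rw [hst] at hs1
  refine (hstep t₀ ht₀ fun r hr => ?_).ne hs1
  by_contra! hr1
  have := hlt r ⟨hr.1, hr.2.trans ht₀.2⟩ hr1.le
  have : r = t₀ := le_antisymm hr.2 this
  rw [this, hs1] at hr1
  exact lt_irrefl _ hr1

theorem IsL2.l2sq_le_of_sub {f g : ℝ → ℝ} (hf : IsL2 f) (hg : IsL2 g) :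
    l2sq f ≤ 2 * l2sq (fun x => f x - g x) + 2 * l2sq g := by
  simpa using (hf.sub hg).l2sq_add_le hg

theorem IsL2.l2sq_sub_le {f g : ℝ → ℝ} (hf : IsL2 f) (hg : IsL2 g) :
    l2sq (fun x => f x - g x) ≤ 2 * l2sq f + 2 * l2sq g := by
  have h := hf.l2sq_add_le (hg.const_mul (-1))
  have e : l2sq (fun x => -1 * g x) = l2sq g := by simp [l2sq]
  rw [e] at h
  simpa [sub_eq_add_neg] using h

theorem SolvesModes.mono {p : Params} {N : ℕ} {τ τ' : ℝ} {f ft g gt : ℝ → ℝ → ℝ}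
    (h : SolvesModes p N τ f ft g gt) (hτ : τ' ≤ τ) : SolvesModes p N τ' f ft g gt := by
  have hsub : Icc 0 τ' ⊆ Icc 0 τ := Icc_subset_Icc_right hτ
  exact ⟨fun t ht => h.isL2_left t (hsub ht), fun t ht => h.isL2_right t (hsub ht),
    fun k hk t ht => (h.deriv_left k hk t (hsub ht)).mono hsub,
    fun k hk t ht => (h.deriv_right k hk t (hsub ht)).mono hsub,
    fun t ht => h.modeEq t (hsub ht)⟩

theorem IsSolution.solvesModes {p : Params} {μ T : ℝ} {ζ₀ u₀ : ℝ → ℝ} {ζ ζt u ut : ℝ → ℝ → ℝ}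
    (hsol : IsSolution p μ T ζ₀ u₀ ζ ζt u ut) (hμ : 0 ≤ μ) (hb : 0 < p.b) (hd : 0 < p.d) (N : ℕ) :
    SolvesModes p N T ζ ζt u ut :=
  ⟨fun t ht => (hsol.c1_ζ.mem t ht).isL2, fun t ht => (hsol.c1_u.mem t ht).isL2,
    fun k _ _ ht => hsol.c1_ζ.hasDerivWithinAt_fhat hμ k ht,
    fun k _ _ ht => hsol.c1_u.hasDerivWithinAt_fhat hμ k ht,
    fun _ ht k _ => hsol.modeEq hb hd ht k⟩

namespace SemidiscreteEqs

variable {p : Params} {T : ℝ} {N : ℕ} {ζ₀ u₀ : ℝ → ℝ} {ζN ζNt uN uNt : ℝ → ℝ → ℝ}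

theorem solvesModes (h : SemidiscreteEqs p T N ζ₀ u₀ ζN ζNt uN uNt) (hb : 0 < p.b)
    (hd : 0 < p.d) : SolvesModes p N T ζN ζNt uN uNt :=
  ⟨fun t ht => (h.mem_ζ t ht).isL2, fun t ht => (h.mem_u t ht).isL2,
    fun k _ _ ht => h.c1_ζ.hasDerivWithinAt_fhat le_rfl k ht,
    fun k _ _ ht => h.c1_u.hasDerivWithinAt_fhat le_rfl k ht,
    fun t ht => (galerkin_iff_modeEq hb hd (h.mem_ζ t ht) (h.mem_ζt t ht) (h.mem_u t ht)
      (h.mem_ut t ht)).mp ⟨h.eq_ζ t ht, h.eq_u t ht⟩⟩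

theorem fhat_init_ζ (h : SemidiscreteEqs p T N ζ₀ u₀ ζN ζNt uN uNt) {k : ℤ} (hk : k ∈ freq N) :
    fhat (ζN 0) k = fhat ζ₀ k := by
  rw [fhat_of_eq_sum h.init_ζ, if_pos hk]

theorem fhat_init_u (h : SemidiscreteEqs p T N ζ₀ u₀ ζN ζNt uN uNt) {k : ℤ} (hk : k ∈ freq N) :
    fhat (uN 0) k = fhat u₀ k := by
  rw [fhat_of_eq_sum h.init_u, if_pos hk]

end SemidiscreteEqs

theorem IsC1Hs.exists_l2sq_le {μ T : ℝ} {f ft : ℝ → ℝ → ℝ} (hμ : 0 ≤ μ) (h : IsC1Hs μ T f ft) :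
    ∃ M, ∀ t ∈ Icc 0 T, l2sq (f t) ≤ M := by
  obtain ⟨M, hM⟩ := h.exists_hsSq_le
  exact ⟨M, fun t ht => ((h.mem t ht).l2sq_le_hsSq hμ).trans (hM t ht)⟩

theorem eq_of_modeSq_eq_zero {N : ℕ} {f g : ℝ → ℝ} (hf : RealMem N f) (hg : RealMem N g)
    (h : modeSq N f g ≤ 0) : f = g := by
  refine hf.ext hg fun k hk => ?_
  have h0 := le_antisymm h (modeSq_nonneg N f g)
  rw [modeSq, Finset.sum_eq_zero_iff_of_nonneg fun _ _ => sq_nonneg _] at h0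
  have := h0 k hk
  rwa [sq_eq_zero_iff, norm_eq_zero, sub_eq_zero] at this

theorem RealMem.l2sq_sub_eq {N : ℕ} {f g : ℝ → ℝ} (hf : RealMem N f) (hg : RealMem N g) :
    l2sq (fun x => f x - g x) = modeSq N f g := by
  refine (hf.isL2.sub hg.isL2).hasSum_sq.unique ?_
  simp only [fhat_sub hf.isL2.intervalIntegrable hg.isL2.intervalIntegrable]
  exact hasSum_sum_of_ne_finset_zero fun k hk => by
    simp [hf.fhat_eq_zero hk, hg.fhat_eq_zero hk]

/-- Two elements of S_N have no tail and the initial coefficients agree, so the energy bound applies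
with ε = 0. -/
theorem IsSemidiscrete.unique {p : Params} (hγ₀ : 0 ≤ p.γ) (hγ₁ : p.γ < 1) (hδ : 0 < p.δ)
    (hb : 0 < p.b) (hd : 0 < p.d) (ha : p.a < 0) (hc : p.c < 0) {T : ℝ} {N : ℕ} {ζ₀ u₀ : ℝ → ℝ}
    {ζN uN ζN' uN' : ℝ → ℝ → ℝ} (h : IsSemidiscrete p T N ζ₀ u₀ ζN uN)
    (h' : IsSemidiscrete p T N ζ₀ u₀ ζN' uN') {t : ℝ} (ht : t ∈ Icc 0 T) :
    ζN t = ζN' t ∧ uN t = uN' t := by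
  obtain ⟨ζNt, uNt, h⟩ := h
  obtain ⟨ζNt', uNt', h'⟩ := h'
  obtain ⟨M₁, hM₁⟩ := h.c1_u.exists_l2sq_le le_rfl
  obtain ⟨M₂, hM₂⟩ := h'.c1_ζ.exists_l2sq_le le_rfl
  obtain ⟨M₃, hM₃⟩ := h'.c1_u.exists_l2sq_le le_rfl
  have n1 := (l2sq_nonneg _).trans (hM₁ t ht)
  have n2 := (l2sq_nonneg _).trans (hM₂ t ht)
  have n3 := (l2sq_nonneg _).trans (hM₃ t ht)
  obtain ⟨K, -, hK⟩ := exists_energy_bound (M := M₁ + M₂ + M₃) (T := T) hγ₀ hγ₁ hδ hb hd ha hc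
    (by positivity)
  have key := hK N T 0 ζN ζNt uN uNt ζN' ζNt' uN' uNt' le_rfl le_rfl (h.solvesModes hb hd)
    (h'.solvesModes hb hd)
    (fun s hs => ⟨by linarith [hM₁ s hs], by linarith [hM₂ s hs], by linarith [hM₃ s hs]⟩)
    (fun s hs => ⟨by rw [(h.mem_ζ s hs).l2sq_sub_eq (h'.mem_ζ s hs), add_zero],
      by rw [(h.mem_u s hs).l2sq_sub_eq (h'.mem_u s hs), add_zero]⟩)
    (fun k hk => by rw [h.fhat_init_ζ hk, h'.fhat_init_ζ hk])
    (fun k hk => by rw [h.fhat_init_u hk, h'.fhat_init_u hk]) t ht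
  have m1 := modeSq_nonneg N (ζN t) (ζN' t)
  have m2 := modeSq_nonneg N (uN t) (uN' t)
  exact ⟨eq_of_modeSq_eq_zero (h.mem_ζ t ht) (h'.mem_ζ t ht) (by linarith),
    eq_of_modeSq_eq_zero (h.mem_u t ht) (h'.mem_u t ht) (by linarith)⟩

/-- A crude bound that may depend on N, meant for the finitely many N below the threshold. -/
theorem IsSemidiscrete.exists_error_le {p : Params} {μ T : ℝ} (hμ : 0 ≤ μ) {N : ℕ}
    {ζ₀ u₀ : ℝ → ℝ} {ζ ζt u ut ζN uN : ℝ → ℝ → ℝ} (hsol : IsSolution p μ T ζ₀ u₀ ζ ζt u ut)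
    (h : IsSemidiscrete p T N ζ₀ u₀ ζN uN) :
    ∃ B, ∀ t ∈ Icc 0 T, l2Norm (fun x => ζN t x - ζ t x) + l2Norm (fun x => uN t x - u t x) ≤ B := by
  obtain ⟨ζNt, uNt, h⟩ := h
  obtain ⟨M₁, hM₁⟩ := h.c1_ζ.exists_l2sq_le le_rfl
  obtain ⟨M₂, hM₂⟩ := h.c1_u.exists_l2sq_le le_rfl
  obtain ⟨M₃, hM₃⟩ := hsol.c1_ζ.exists_l2sq_le hμ
  obtain ⟨M₄, hM₄⟩ := hsol.c1_u.exists_l2sq_le hμ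
  refine ⟨√(2 * M₁ + 2 * M₃) + √(2 * M₂ + 2 * M₄), fun t ht => ?_⟩
  refine add_le_add (Real.sqrt_le_sqrt ?_) (Real.sqrt_le_sqrt ?_)
  · exact ((h.mem_ζ t ht).isL2.l2sq_sub_le (hsol.c1_ζ.mem t ht).isL2).trans
      (by linarith [hM₁ t ht, hM₃ t ht])
  · exact ((h.mem_u t ht).isL2.l2sq_sub_le (hsol.c1_u.mem t ht).isL2).trans
      (by linarith [hM₂ t ht, hM₄ t ht])

/-- Convergence at the optimal rate, together with an a priori bound; the equations need only hold
where that bound does. -/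
theorem IsSolution.exists_convergence_bound {p : Params} (hγ₀ : 0 ≤ p.γ) (hγ₁ : p.γ < 1)
    (hδ : 0 < p.δ) (hb : 0 < p.b) (hd : 0 < p.d) (ha : p.a < 0) (hc : p.c < 0) {μ T : ℝ}
    (hμ : 0 < μ) {ζ₀ u₀ : ℝ → ℝ} {ζ ζt u ut : ℝ → ℝ → ℝ}
    (hsol : IsSolution p μ T ζ₀ u₀ ζ ζt u ut) :
    ∃ (K M : ℝ) (N₀ : ℕ), ∀ N : ℕ, 1 ≤ N → N₀ ≤ N → ∀ f ft g gt : ℝ → ℝ → ℝ,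
      (∀ t ∈ Icc 0 T, RealMem N (f t)) → (∀ t ∈ Icc 0 T, RealMem N (g t)) →
      (∀ k ∈ freq N, ∀ t ∈ Icc 0 T,
        HasDerivWithinAt (fun s => fhat (f s) k) (fhat (ft t) k) (Icc 0 T) t) →
      (∀ k ∈ freq N, ∀ t ∈ Icc 0 T,
        HasDerivWithinAt (fun s => fhat (g s) k) (fhat (gt t) k) (Icc 0 T) t) →
      (∀ k ∈ freq N, fhat (f 0) k = fhat ζ₀ k) → (∀ k ∈ freq N, fhat (g 0) k = fhat u₀ k) →
      (∀ t ∈ Icc 0 T, l2sq (f t) ≤ M → l2sq (g t) ≤ M →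
        ∀ k ∈ freq N, ModeEq p k (f t) (ft t) (g t) (gt t)) →
      ∀ t ∈ Icc 0 T, l2sq (f t) ≤ M ∧ l2sq (g t) ≤ M ∧
        l2sq (fun x => f t x - ζ t x) ≤ K * ((N : ℝ) ^ (-μ)) ^ 2 ∧
        l2sq (fun x => g t x - u t x) ≤ K * ((N : ℝ) ^ (-μ)) ^ 2 := by
  obtain ⟨M₁, hM₁⟩ := hsol.c1_ζ.exists_hsSq_le
  obtain ⟨M₂, hM₂⟩ := hsol.c1_u.exists_hsSq_le
  set M₀ := max 0 (max M₁ M₂)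
  have hM₀ : 0 ≤ M₀ := le_max_left _ _
  have hζ : ∀ t ∈ Icc 0 T, hsSq μ (ζ t) ≤ M₀ := fun t ht =>
    (hM₁ t ht).trans ((le_max_left _ _).trans (le_max_right _ _))
  have hu : ∀ t ∈ Icc 0 T, hsSq μ (u t) ≤ M₀ := fun t ht =>
    (hM₂ t ht).trans ((le_max_right _ _).trans (le_max_right _ _))
  -- If the mode error and the tail are each at most 1, the squared L² error is at most 2, and ‖f‖²
  -- ≤ 2·2 + 2‖ζ‖²; likewise for the other component.
  set M := 4 + 2 * M₀
  obtain ⟨K, hK0, hK⟩ := exists_energy_bound (M := M) (T := T) hγ₀ hγ₁ hδ hb hd ha hc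
    (by positivity)
  have hlim : Tendsto (fun N : ℕ => (K + 1) * (((N : ℝ) ^ (-μ)) ^ 2 * M₀)) atTop (𝓝 0) := by
    have h1 := (tendsto_rpow_neg_atTop hμ).comp (tendsto_natCast_atTop_atTop (R := ℝ))
    simpa using ((h1.pow 2).mul_const M₀).const_mul (K + 1)
  -- With (K + 1)ε < 1 both the tail ε and the improved error Kε are below 1, as the continuity
  -- argument requires.
  obtain ⟨N₀, hN₀⟩ := eventually_atTop.mp (hlim.eventually_lt_const one_pos)
  refine ⟨(K + 1) * M₀, M, N₀, ?_⟩
  intro N hN hNN f ft g gt hf hg hdf hdg hf0 hg0 heq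
  set ε := ((N : ℝ) ^ (-μ)) ^ 2 * M₀ with hε_def
  have hε : 0 ≤ ε := by positivity
  have hKε : (K + 1) * ε < 1 := hN₀ N hNN
  have hKε0 : 0 ≤ K * ε := by positivity
  have tail₁ : ∀ t ∈ Icc 0 T, l2sq (fun x => f t x - ζ t x) ≤ modeSq N (f t) (ζ t) + ε :=
    fun t ht => ((hf t ht).l2sq_sub_le hN hμ.le (hsol.c1_ζ.mem t ht)).trans
      (add_le_add le_rfl (mul_le_mul_of_nonneg_left (hζ t ht) (sq_nonneg _)))
  have tail₂ : ∀ t ∈ Icc 0 T, l2sq (fun x => g t x - u t x) ≤ modeSq N (g t) (u t) + ε :=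
    fun t ht => ((hg t ht).l2sq_sub_le hN hμ.le (hsol.c1_u.mem t ht)).trans
      (add_le_add le_rfl (mul_le_mul_of_nonneg_left (hu t ht) (sq_nonneg _)))
  have hζL : ∀ t ∈ Icc 0 T, l2sq (ζ t) ≤ M₀ := fun t ht =>
    ((hsol.c1_ζ.mem t ht).l2sq_le_hsSq hμ.le).trans (hζ t ht)
  have huL : ∀ t ∈ Icc 0 T, l2sq (u t) ≤ M₀ := fun t ht =>
    ((hsol.c1_u.mem t ht).l2sq_le_hsSq hμ.le).trans (hu t ht)
  set y : ℝ → ℝ := fun t => modeSq N (f t) (ζ t) + modeSq N (g t) (u t) with hy_def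
  have hsol' := hsol.solvesModes hμ.le hb hd N
  have hycont : ContinuousOn y (Icc 0 T) := by
    refine ContinuousOn.add ?_ ?_
    · refine continuousOn_finsetSum _ fun k hk => ContinuousOn.pow (ContinuousOn.norm ?_) 2
      exact fun t ht => (hdf k hk t ht).continuousWithinAt.sub
        (hsol'.deriv_left k hk t ht).continuousWithinAt
    · refine continuousOn_finsetSum _ fun k hk => ContinuousOn.pow (ContinuousOn.norm ?_) 2
      exact fun t ht => (hdg k hk t ht).continuousWithinAt.sub
        (hsol'.deriv_right k hk t ht).continuousWithinAt
  have hy0 : y 0 = 0 := by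
    simp only [hy_def, modeSq, hsol.init_ζ, hsol.init_u]
    rw [Finset.sum_eq_zero fun k hk => by rw [hf0 k hk]; simp,
      Finset.sum_eq_zero fun k hk => by rw [hg0 k hk]; simp, add_zero]
  have hbd : ∀ t ∈ Icc 0 T, y t ≤ 1 → l2sq (f t) ≤ M ∧ l2sq (g t) ≤ M := fun t ht hyt => by
    have m1 := modeSq_nonneg N (f t) (ζ t)
    have m2 := modeSq_nonneg N (g t) (u t)
    have a1 := (hf t ht).isL2.l2sq_le_of_sub (hsol.c1_ζ.mem t ht).isL2
    have a2 := (hg t ht).isL2.l2sq_le_of_sub (hsol.c1_u.mem t ht).isL2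
    have hyt' : modeSq N (f t) (ζ t) + modeSq N (g t) (u t) ≤ 1 := hyt
    have hε1 : ε ≤ 1 := by linarith
    constructor
    · linarith [tail₁ t ht, hζL t ht]
    · linarith [tail₂ t ht, huL t ht]
  have hest : ∀ τ ∈ Icc 0 T, (∀ s ∈ Icc 0 τ, y s ≤ 1) → y τ ≤ K * ε := by
    intro τ hτ hs
    have hsub : Icc 0 τ ⊆ Icc 0 T := Icc_subset_Icc_right hτ.2
    refine hK N τ ε f ft g gt ζ ζt u ut hτ.2 hε ⟨fun t ht => (hf t (hsub ht)).isL2,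
      fun t ht => (hg t (hsub ht)).isL2, fun k hk t ht => (hdf k hk t (hsub ht)).mono hsub,
      fun k hk t ht => (hdg k hk t (hsub ht)).mono hsub, fun t ht => ?_⟩ (hsol'.mono hτ.2)
      (fun t ht => ⟨(hbd t (hsub ht) (hs t ht)).2, ?_, ?_⟩)
      (fun t ht => ⟨tail₁ t (hsub ht), tail₂ t (hsub ht)⟩)
      (fun k hk => by rw [hsol.init_ζ, hf0 k hk]) (fun k hk => by rw [hsol.init_u, hg0 k hk])
      τ ⟨hτ.1, le_rfl⟩
    · have := hbd t (hsub ht) (hs t ht)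
      exact heq t (hsub ht) this.1 this.2
    · linarith [hζL t (hsub ht)]
    · linarith [huL t (hsub ht)]
  -- Assuming y ≤ 1 up to τ activates the L² bounds, hence the equations, and returns y(τ) ≤ Kε < 1.
  have hy1 : ∀ t ∈ Icc 0 T, y t < 1 := le_one_of_bootstrap hycont (by rw [hy0]; exact one_pos)
    fun τ hτ hs => (hest τ hτ hs).trans_lt (by linarith)
  intro t ht
  have hyt := hest t ht fun s hs => (hy1 s ⟨hs.1, hs.2.trans ht.2⟩).le
  have hyt' : modeSq N (f t) (ζ t) + modeSq N (g t) (u t) ≤ K * ε := hyt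
  have m1 := modeSq_nonneg N (f t) (ζ t)
  have m2 := modeSq_nonneg N (g t) (u t)
  have e : (K + 1) * M₀ * ((N : ℝ) ^ (-μ)) ^ 2 = K * ε + ε := by rw [hε_def]; ring
  refine ⟨(hbd t ht (hy1 t ht).le).1, (hbd t ht (hy1 t ht).le).2, ?_, ?_⟩
  · rw [e]; linarith [tail₁ t ht]
  · rw [e]; linarith [tail₂ t ht]

/-! ### Existence of semidiscrete solutions -/

/-- Since ‖G‖ ≤ L, a ball of radius LT cannot be left before time T, so a single Picard–Lindelöf
step covers the whole interval. -/
theorem exists_hasDerivWithinAt_of_lipschitz_of_bounded {E : Type*} [NormedAddCommGroup E]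
    [NormedSpace ℝ E] [CompleteSpace E] {G : E → E} {K : ℝ≥0} (hG : LipschitzWith K G) {L : ℝ≥0}
    (hL : ∀ x, ‖G x‖ ≤ L) (x₀ : E) {T : ℝ} (hT : 0 ≤ T) :
    ∃ y : ℝ → E, y 0 = x₀ ∧ ∀ t ∈ Icc 0 T, HasDerivWithinAt y (G (y t)) (Icc 0 T) t := by
  have h : IsPicardLindelof (fun _ => G) (tmin := 0) (tmax := T) ⟨0, le_rfl, hT⟩ x₀
      (L * ⟨T, hT⟩) 0 L K := by
    refine IsPicardLindelof.of_time_independent (fun x _ => hL x) hG.lipschitzOnWith ?_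
    change (L : ℝ) * max (T - 0) (0 - 0) ≤ L * T - 0
    simp [max_eq_left hT]
  exact h.exists_eq_forall_mem_Icc_hasDerivWithinAt₀

/-- The real trigonometric polynomial with prescribed coefficients for `|k| ≤ N`. -/
noncomputable def realPoly {N : ℕ} (z : freq N → ℂ) : ℝ → ℝ :=
  trigRe N fun k => if h : k ∈ freq N then z ⟨k, h⟩ else 0

theorem realMem_realPoly {N : ℕ} (z : freq N → ℂ) : RealMem N (realPoly z) := realMem_trigRe _ _

/-- The `k`-th Fourier coefficient of `realPoly z`, as a real-linear function of `z`. -/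
noncomputable def coeffMap {N : ℕ} (k : freq N) : (freq N → ℂ) →L[ℝ] ℂ :=
  (1 / 2 : ℝ) • (ContinuousLinearMap.proj (φ := fun _ : freq N => ℂ) k +
    (Complex.conjCLE : ℂ →L[ℝ] ℂ).comp (ContinuousLinearMap.proj (φ := fun _ : freq N => ℂ)
      ⟨-(k : ℤ), neg_mem_freq.mpr k.2⟩))

theorem coeffMap_apply {N : ℕ} (k : freq N) (z : freq N → ℂ) :
    coeffMap k z = (z k + conj (z ⟨-k, neg_mem_freq.mpr k.2⟩)) / 2 := by
  simp [coeffMap]; ring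

theorem fhat_realPoly {N : ℕ} (z : freq N → ℂ) (k : freq N) :
    fhat (realPoly z) k = coeffMap k z := by
  rw [realPoly, fhat_trigRe N _ k.2, coeffMap_apply]
  simp only [dif_pos k.2, dif_pos (neg_mem_freq.mpr k.2)]

theorem coeffMap_of_symm {N : ℕ} {z : freq N → ℂ}
    (h : ∀ k : freq N, z ⟨-k, neg_mem_freq.mpr k.2⟩ = conj (z k)) (k : freq N) :
    coeffMap k z = z k := by
  rw [coeffMap_apply, h, Complex.conj_conj]; ring

/-- Symmetrization of coefficient vectors. -/
noncomputable def symmetrize (N : ℕ) : (freq N → ℂ) →L[ℝ] (freq N → ℂ) :=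
  ContinuousLinearMap.pi coeffMap

theorem symmetrize_apply {N : ℕ} (z : freq N → ℂ) (k : freq N) :
    symmetrize N z k = fhat (realPoly z) k := (fhat_realPoly z k).symm

/-- Symmetrizing does not change the represented function, so composing the vector field with it
leaves the equations intact. -/
theorem realPoly_symmetrize {N : ℕ} (z : freq N → ℂ) : realPoly (symmetrize N z) = realPoly z := by
  refine (realMem_realPoly _).ext (realMem_realPoly _) fun k hk => ?_
  rw [fhat_realPoly _ ⟨k, hk⟩, coeffMap_of_symm, symmetrize_apply]
  intro j
  rw [symmetrize_apply, symmetrize_apply, fhat_neg]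

/-- The finite convolution formula makes the nonlinearity polynomial in the coefficients, hence the
Galerkin vector field smooth. -/
theorem fhat_mul_of_realMem {N : ℕ} {f g : ℝ → ℝ} (hf : RealMem N f) (hg : RealMem N g) (k : ℤ) :
    fhat (fun x => f x * g x) k = ∑ i ∈ freq N, ∑ j ∈ freq N,
      fhat f i * fhat g j * if i + j = k then 1 else 0 := by
  have h : ∀ x, ((f x * g x : ℝ) : ℂ) * conj (expo k x) = ∑ i ∈ freq N, ∑ j ∈ freq N,
      fhat f i * fhat g j * (expo (i + j) x * conj (expo k x)) := fun x => by
    push_cast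
    rw [hf.eq_sum, hg.eq_sum, Finset.sum_mul_sum, Finset.sum_mul]
    refine Finset.sum_congr rfl fun i _ => ?_
    rw [Finset.sum_mul]
    refine Finset.sum_congr rfl fun j _ => ?_
    rw [expo_add]; ring
  have hc : ∀ j : ℤ, Continuous fun x => expo j x * conj (expo k x) := fun j =>
    (continuous_expo j).mul (Complex.continuous_conj.comp (continuous_expo k))
  have hi : ∀ i j : ℤ, IntervalIntegrable
      (fun x => fhat f i * fhat g j * (expo (i + j) x * conj (expo k x))) volume 0 1 :=
    fun i j => (continuous_const.mul (hc (i + j))).intervalIntegrable _ _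
  have hs : ∀ i : ℤ, IntervalIntegrable (fun x => ∑ j ∈ freq N,
      fhat f i * fhat g j * (expo (i + j) x * conj (expo k x))) volume 0 1 :=
    fun i => (continuous_finsetSum _ fun j _ =>
      continuous_const.mul (hc (i + j))).intervalIntegrable _ _
  rw [fhat_eq]
  simp only [h]
  rw [intervalIntegral.integral_finsetSum fun i _ => hs i]
  refine Finset.sum_congr rfl fun i _ => ?_
  rw [intervalIntegral.integral_finsetSum fun j _ => hi i j]
  simp only [intervalIntegral.integral_const_mul, integral_expo_mul_conj]

theorem contDiff_fhat_realPoly {N : ℕ} {k : ℤ} (hk : k ∈ freq N) :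
    ContDiff ℝ 1 fun z : freq N → ℂ => fhat (realPoly z) k := by
  simp only [fhat_realPoly _ ⟨k, hk⟩]
  exact (coeffMap _).contDiff

theorem contDiff_fhat_realPoly_mul {N : ℕ} (k : ℤ) :
    ContDiff ℝ 1 fun z : (freq N → ℂ) × (freq N → ℂ) =>
      fhat (fun x => realPoly z.1 x * realPoly z.2 x) k := by
  simp only [fhat_mul_of_realMem (realMem_realPoly _) (realMem_realPoly _)]
  refine ContDiff.sum fun i hi => ContDiff.sum fun j hj => ContDiff.mul (ContDiff.mul ?_ ?_)
    contDiff_const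
  · exact (contDiff_fhat_realPoly hi).comp contDiff_fst
  · exact (contDiff_fhat_realPoly hj).comp contDiff_snd

theorem contDiff_modeRate (κ l a b : ℝ) (k : ℤ) {E : Type*} [NormedAddCommGroup E]
    [NormedSpace ℝ E] {B Q : E → ℂ} (hB : ContDiff ℝ 1 B) (hQ : ContDiff ℝ 1 Q) :
    ContDiff ℝ 1 fun z => modeRate κ l a b k (B z) (Q z) := by
  unfold modeRate
  exact (contDiff_const.mul ((contDiff_const.mul hB).add (contDiff_const.mul hQ))).div_const _

/-- The vector field of the semidiscrete problem on coefficient vectors. -/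
noncomputable def galerkinField (p : Params) (N : ℕ) (z : (freq N → ℂ) × (freq N → ℂ)) :
    (freq N → ℂ) × (freq N → ℂ) :=
  (fun k => modeRate p.κ₁ p.lam p.a p.b k (fhat (realPoly z.2) k)
      (fhat (fun x => realPoly z.1 x * realPoly z.2 x) k),
    fun k => modeRate p.κ₂ p.lam p.c' p.d k (fhat (realPoly z.1) k)
      (fhat (fun x => realPoly z.2 x ^ 2 / 2) k))

theorem contDiff_galerkinField (p : Params) (N : ℕ) : ContDiff ℝ 1 (galerkinField p N) := by
  refine ContDiff.prodMk (contDiff_pi.mpr fun k => ?_) (contDiff_pi.mpr fun k => ?_)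
  · exact contDiff_modeRate _ _ _ _ _ ((contDiff_fhat_realPoly k.2).comp contDiff_snd)
      (contDiff_fhat_realPoly_mul k)
  · refine contDiff_modeRate _ _ _ _ _ ((contDiff_fhat_realPoly k.2).comp contDiff_fst) ?_
    simp only [fhat_half_sq]
    have h : ContDiff ℝ 1 fun z : (freq N → ℂ) × (freq N → ℂ) => (z.2, z.2) :=
      contDiff_snd.prodMk contDiff_snd
    have h' := (contDiff_fhat_realPoly_mul (N := N) k).comp h
    exact contDiff_const.mul h'

/-! ### Curves in S_N and the cut-off problem -/

theorem RealMem.const_mul {N : ℕ} {f : ℝ → ℝ} (hf : RealMem N f) (c : ℝ) :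
    RealMem N fun x => c * f x := by
  have := (trigSpace N).smul_mem (c : ℂ) hf
  refine (congrArg (· ∈ trigSpace N) ?_).mp this
  funext x; simp

theorem RealMem.sub {N : ℕ} {f g : ℝ → ℝ} (hf : RealMem N f) (hg : RealMem N g) :
    RealMem N fun x => f x - g x := by
  have := (trigSpace N).sub_mem hf hg
  refine (congrArg (· ∈ trigSpace N) ?_).mp this
  funext x; simp

theorem RealMem.hsNorm_eq {N : ℕ} {f : ℝ → ℝ} (hf : RealMem N f) (μ : ℝ) :
    hsNorm μ f = √(∑ k ∈ freq N, (1 + (k : ℝ) ^ 2) ^ μ * ‖fhat f k‖ ^ 2) := by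
  rw [hsNorm, tsum_eq_sum fun k hk => by simp [hf.fhat_eq_zero hk]]

/-- On S_N the `H^μ` norm is a finite sum, so coefficientwise convergence suffices. -/
theorem tendsto_hsNorm_zero {ι : Type*} {l : Filter ι} {N : ℕ} (μ : ℝ) {F : ι → ℝ → ℝ}
    (hF : ∀ᶠ s in l, RealMem N (F s))
    (h : ∀ k ∈ freq N, Tendsto (fun s => fhat (F s) k) l (𝓝 0)) :
    Tendsto (fun s => hsNorm μ (F s)) l (𝓝 0) := by
  have h1 : Tendsto (fun s => √(∑ k ∈ freq N, (1 + (k : ℝ) ^ 2) ^ μ * ‖fhat (F s) k‖ ^ 2)) l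
      (𝓝 √(∑ k ∈ freq N, (1 + (k : ℝ) ^ 2) ^ μ * ‖(0 : ℂ)‖ ^ 2)) :=
    (tendsto_finsetSum _ fun k hk => ((h k hk).norm.pow 2).const_mul _).sqrt
  simp only [norm_zero, ne_eq, OfNat.ofNat_ne_zero, not_false_eq_true, zero_pow, mul_zero,
    Finset.sum_const_zero, Real.sqrt_zero] at h1
  refine h1.congr' ?_
  filter_upwards [hF] with s hs
  rw [hs.hsNorm_eq]

theorem isC1Hs_of_realMem {N : ℕ} (μ : ℝ) {T : ℝ} {f ft : ℝ → ℝ → ℝ}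
    (hf : ∀ t ∈ Icc 0 T, RealMem N (f t)) (hft : ∀ t ∈ Icc 0 T, RealMem N (ft t))
    (hd : ∀ k ∈ freq N, ∀ t ∈ Icc 0 T,
      HasDerivWithinAt (fun s => fhat (f s) k) (fhat (ft t) k) (Icc 0 T) t)
    (hc : ∀ k ∈ freq N, ContinuousOn (fun s => fhat (ft s) k) (Icc 0 T)) : IsC1Hs μ T f ft where
  mem t ht := (hf t ht).memHs μ
  mem_deriv t ht := (hft t ht).memHs μ
  hasDeriv t ht := by
    refine tendsto_hsNorm_zero (N := N) μ ?_ fun k hk => ?_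
    · filter_upwards [self_mem_nhdsWithin] with s hs
      exact (((hf s hs.1).sub (hf t ht)).const_mul _).sub (hft t ht)
    · have h1 := hasDerivWithinAt_iff_tendsto_slope.mp (hd k hk t ht)
      rw [← tendsto_sub_nhds_zero_iff] at h1
      refine h1.congr' ?_
      filter_upwards [self_mem_nhdsWithin] with s hs
      have i1 := (hf s hs.1).isL2
      have i2 := (hf t ht).isL2
      rw [fhat_sub ((i1.sub i2).const_mul _).intervalIntegrable (hft t ht).isL2.intervalIntegrable,
        fhat_const_mul, fhat_sub i1.intervalIntegrable i2.intervalIntegrable, slope_def_module]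
      simp
  cont t ht := by
    refine tendsto_hsNorm_zero (N := N) μ ?_ fun k hk => ?_
    · filter_upwards [self_mem_nhdsWithin] with s hs
      exact (hft s hs).sub (hft t ht)
    · have h1 : Tendsto (fun s => fhat (ft s) k) (𝓝[Icc 0 T] t) (𝓝 (fhat (ft t) k)) := hc k hk t ht
      rw [← tendsto_sub_nhds_zero_iff] at h1
      refine h1.congr' ?_
      filter_upwards [self_mem_nhdsWithin] with s hs
      rw [fhat_sub (hft s hs).isL2.intervalIntegrable (hft t ht).isL2.intervalIntegrable]

theorem IsL2.norm_fhat_sq_le {f : ℝ → ℝ} (hf : IsL2 f) (k : ℤ) : ‖fhat f k‖ ^ 2 ≤ l2sq f :=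
  le_hasSum hf.hasSum_sq k fun _ _ => sq_nonneg _

/-- Solutions of the semidiscrete problem with the nonlinearity cut off outside a ball of `L²`. -/
theorem exists_cutoff_solution (p : Params) (N : ℕ) {T M : ℝ} (hT : 0 ≤ T)
    (ζ₀ u₀ : ℝ → ℝ) :
    ∃ f ft g gt : ℝ → ℝ → ℝ, (∀ t, RealMem N (f t)) ∧ (∀ t, RealMem N (ft t)) ∧
      (∀ t, RealMem N (g t)) ∧ (∀ t, RealMem N (gt t)) ∧
      (∀ k ∈ freq N, ∀ t ∈ Icc 0 T,
        HasDerivWithinAt (fun s => fhat (f s) k) (fhat (ft t) k) (Icc 0 T) t) ∧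
      (∀ k ∈ freq N, ∀ t ∈ Icc 0 T,
        HasDerivWithinAt (fun s => fhat (g s) k) (fhat (gt t) k) (Icc 0 T) t) ∧
      (∀ k ∈ freq N, ContinuousOn (fun s => fhat (ft s) k) (Icc 0 T)) ∧
      (∀ k ∈ freq N, ContinuousOn (fun s => fhat (gt s) k) (Icc 0 T)) ∧
      (∀ k ∈ freq N, fhat (f 0) k = fhat ζ₀ k) ∧ (∀ k ∈ freq N, fhat (g 0) k = fhat u₀ k) ∧
      ∀ t ∈ Icc 0 T, l2sq (f t) ≤ M → l2sq (g t) ≤ M →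
        ∀ k ∈ freq N, ModeEq p k (f t) (ft t) (g t) (gt t) := by
  -- The cutoff equals 1 up to radius √M + 1; adding 1 keeps this radius positive when √M = 0.
  let χ : ContDiffBump (0 : (freq N → ℂ) × (freq N → ℂ)) := ⟨√M + 1, √M + 2, by positivity, by linarith⟩
  let H : (freq N → ℂ) × (freq N → ℂ) → (freq N → ℂ) × (freq N → ℂ) :=
    fun z => χ z • galerkinField p N z
  have hHsmooth : ContDiff ℝ 1 H := χ.contDiff.smul (contDiff_galerkinField p N)
  have hHsupp : HasCompactSupport H := χ.hasCompactSupport.smul_right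
  obtain ⟨K, hK⟩ := ContDiff.lipschitzWith_of_hasCompactSupport hHsupp hHsmooth one_ne_zero
  obtain ⟨L, hL⟩ := hHsupp.exists_bound_of_continuous hHsmooth.continuous
  -- An L² bound on `realPoly z` controls only the symmetrized coefficients, so the cutoff has to be
  -- evaluated on these.
  let Sym := (symmetrize N).prodMap (symmetrize N)
  obtain ⟨y, hy0, hy⟩ := exists_hasDerivWithinAt_of_lipschitz_of_bounded
    (G := fun z => H (Sym z)) (L := L.toNNReal) (hK.comp Sym.lipschitz)
    (fun z => (hL _).trans (Real.le_coe_toNNReal L))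
    (fun k => fhat ζ₀ k, fun k => fhat u₀ k) hT
  have hycont : ContinuousOn y (Icc 0 T) := fun t ht => (hy t ht).continuousWithinAt
  have hHy : ContinuousOn (fun t => H (Sym (y t))) (Icc 0 T) :=
    (hHsmooth.continuous.comp Sym.continuous).comp_continuousOn hycont
  have hinit : ∀ (v : ℝ → ℝ) (k : freq N), coeffMap k (fun j : freq N => fhat v j) = fhat v k :=
    fun v => coeffMap_of_symm fun k => fhat_neg v k
  refine ⟨fun t => realPoly (y t).1, fun t => realPoly (H (Sym (y t))).1,
    fun t => realPoly (y t).2, fun t => realPoly (H (Sym (y t))).2,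
    fun t => realMem_realPoly _, fun t => realMem_realPoly _, fun t => realMem_realPoly _,
    fun t => realMem_realPoly _, fun k hk t ht => ?_, fun k hk t ht => ?_, fun k hk => ?_,
    fun k hk => ?_, fun k hk => ?_, fun k hk => ?_, fun t ht hft hgt k hk => ?_⟩
  · simp only [fhat_realPoly _ ⟨k, hk⟩]
    exact ((coeffMap ⟨k, hk⟩).comp (ContinuousLinearMap.fst ℝ _ _)).hasFDerivAt.comp_hasDerivWithinAt
      t (hy t ht)
  · simp only [fhat_realPoly _ ⟨k, hk⟩]
    exact ((coeffMap ⟨k, hk⟩).comp (ContinuousLinearMap.snd ℝ _ _)).hasFDerivAt.comp_hasDerivWithinAt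
      t (hy t ht)
  · simp only [fhat_realPoly _ ⟨k, hk⟩]
    exact (coeffMap ⟨k, hk⟩).continuous.comp_continuousOn (continuous_fst.comp_continuousOn hHy)
  · simp only [fhat_realPoly _ ⟨k, hk⟩]
    exact (coeffMap ⟨k, hk⟩).continuous.comp_continuousOn (continuous_snd.comp_continuousOn hHy)
  · rw [fhat_realPoly _ ⟨k, hk⟩, hy0, hinit]
  · rw [fhat_realPoly _ ⟨k, hk⟩, hy0, hinit]
  · have hnorm : ∀ z : freq N → ℂ, l2sq (realPoly z) ≤ M → ‖symmetrize N z‖ ≤ √M := fun z hz => by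
      rw [pi_norm_le_iff_of_nonneg (Real.sqrt_nonneg M)]
      intro j
      rw [symmetrize_apply]
      exact Real.le_sqrt_of_sq_le (((realMem_realPoly z).isL2.norm_fhat_sq_le j).trans hz)
    have hχ : χ (Sym (y t)) = 1 := χ.one_of_mem_closedBall <| by
      rw [mem_closedBall_zero_iff]
      have h1 := hnorm _ hft
      have h2 := hnorm _ hgt
      exact (max_le h1 h2).trans (by change _ ≤ √M + 1; linarith)
    have hH : H (Sym (y t)) = galerkinField p N (y t) := by
      change χ (Sym (y t)) • galerkinField p N (Sym (y t)) = _
      rw [hχ, one_smul]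
      simp only [galerkinField, Sym, ContinuousLinearMap.coe_prodMap', Prod.map, realPoly_symmetrize]
    constructor
    · simp only [hH]
      rw [fhat_realPoly _ ⟨k, hk⟩, coeffMap_of_symm]
      · rfl
      · intro j
        simp only [galerkinField, fhat_neg, modeRate_neg]
    · simp only [hH]
      rw [fhat_realPoly _ ⟨k, hk⟩, coeffMap_of_symm]
      · rfl
      · intro j
        simp only [galerkinField, fhat_neg, modeRate_neg]

/-! ### Assembling the theorem -/

theorem l2Norm_le_of_l2sq_le {f : ℝ → ℝ} {K r : ℝ} (hr : 0 ≤ r) (h : l2sq f ≤ K * r ^ 2) :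
    l2Norm f ≤ √K * r := by
  refine (Real.sqrt_le_sqrt h).trans ?_
  rw [mul_comm, Real.sqrt_mul (sq_nonneg r), Real.sqrt_sq hr, mul_comm]

/-- A bound depending on `N` can be chosen uniformly over finitely many `N`. -/
theorem exists_uniform_bound {P : ℕ → ℝ → Prop} (hP : ∀ N, ∃ C, P N C)
    (hmono : ∀ N C C', C ≤ C' → P N C → P N C') (n : ℕ) : ∃ C, ∀ N < n, P N C := by
  choose C hC using hP
  refine ⟨∑ N ∈ Finset.range n, |C N|, fun N hN => hmono N _ _ ?_ (hC N)⟩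
  exact (le_abs_self _).trans
    (Finset.single_le_sum (f := fun N => |C N|) (fun _ _ => abs_nonneg _) (Finset.mem_range.mpr hN))

/-- The cut-off solution obeys the true equations wherever the L² bound `M` holds; `hbound` says
that this is all of [0,T]. -/
theorem exists_isSemidiscrete {p : Params} (hb : 0 < p.b) (hd : 0 < p.d)
    {T : ℝ} (hT : 0 ≤ T) {M : ℝ} {N : ℕ} {ζ₀ u₀ : ℝ → ℝ}
    (hbound : ∀ f ft g gt : ℝ → ℝ → ℝ,
      (∀ t ∈ Icc 0 T, RealMem N (f t)) → (∀ t ∈ Icc 0 T, RealMem N (g t)) →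
      (∀ k ∈ freq N, ∀ t ∈ Icc 0 T,
        HasDerivWithinAt (fun s => fhat (f s) k) (fhat (ft t) k) (Icc 0 T) t) →
      (∀ k ∈ freq N, ∀ t ∈ Icc 0 T,
        HasDerivWithinAt (fun s => fhat (g s) k) (fhat (gt t) k) (Icc 0 T) t) →
      (∀ k ∈ freq N, fhat (f 0) k = fhat ζ₀ k) → (∀ k ∈ freq N, fhat (g 0) k = fhat u₀ k) →
      (∀ t ∈ Icc 0 T, l2sq (f t) ≤ M → l2sq (g t) ≤ M →
        ∀ k ∈ freq N, ModeEq p k (f t) (ft t) (g t) (gt t)) →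
      ∀ t ∈ Icc 0 T, l2sq (f t) ≤ M ∧ l2sq (g t) ≤ M) :
    ∃ ζN uN : ℝ → ℝ → ℝ, IsSemidiscrete p T N ζ₀ u₀ ζN uN := by
  obtain ⟨f, ft, g, gt, hf, hft, hg, hgt, hdf, hdg, hcf, hcg, hf0, hg0, heq⟩ :=
    exists_cutoff_solution p N (M := M) hT ζ₀ u₀
  have hM := hbound f ft g gt (fun t _ => hf t) (fun t _ => hg t) hdf hdg hf0 hg0 heq
  have hsd := fun t ht => (galerkin_iff_modeEq hb hd (hf t) (hft t) (hg t) (hgt t)).mpr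
    (heq t ht (hM t ht).1 (hM t ht).2)
  refine ⟨f, g, ft, gt, fun t _ => hf t, fun t _ => hg t, fun t _ => hft t, fun t _ => hgt t,
    isC1Hs_of_realMem 0 (fun t _ => hf t) (fun t _ => hft t) hdf hcf,
    isC1Hs_of_realMem 0 (fun t _ => hg t) (fun t _ => hgt t) hdg hcg, fun x => ?_, fun x => ?_,
    fun t ht => (hsd t ht).1, fun t ht => (hsd t ht).2⟩
  · rw [(hf 0).eq_sum]
    exact Finset.sum_congr rfl fun k hk => by rw [hf0 k hk]
  · rw [(hg 0).eq_sum]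
    exact Finset.sum_congr rfl fun k hk => by rw [hg0 k hk]

end BBGalerkin

open BBGalerkin

theorem mainTheorem2 (p : BBGalerkin.Params)
    (hγ₀ : 0 ≤ p.γ) (hγ₁ : p.γ < 1) (hδ : 0 < p.δ)
    (hb : 0 < p.b) (hd : 0 < p.d) (ha : p.a < 0) (hc : p.c < 0)
    (μ T : ℝ) (hμ : 1 ≤ μ) (hT : 0 < T)
    (ζ₀ u₀ : ℝ → ℝ) (ζ ζt u ut : ℝ → ℝ → ℝ)
    (hsol : BBGalerkin.IsSolution p μ T ζ₀ u₀ ζ ζt u ut) :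
    ∃ (C : ℝ) (N₀ : ℕ), ∀ N : ℕ, 1 ≤ N →
      (N₀ ≤ N → ∃ ζN uN : ℝ → ℝ → ℝ, BBGalerkin.IsSemidiscrete p T N ζ₀ u₀ ζN uN) ∧
      (∀ ζN uN ζN' uN' : ℝ → ℝ → ℝ,
        BBGalerkin.IsSemidiscrete p T N ζ₀ u₀ ζN uN →
        BBGalerkin.IsSemidiscrete p T N ζ₀ u₀ ζN' uN' →
        ∀ t ∈ Set.Icc 0 T, ζN t = ζN' t ∧ uN t = uN' t) ∧
      (∀ ζN uN : ℝ → ℝ → ℝ, BBGalerkin.IsSemidiscrete p T N ζ₀ u₀ ζN uN →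
        ∀ t ∈ Set.Icc 0 T,
          BBGalerkin.l2Norm (fun x => ζN t x - ζ t x) +
            BBGalerkin.l2Norm (fun x => uN t x - u t x) ≤ C * (N : ℝ) ^ (-μ)) := by
  have hμ0 : 0 < μ := one_pos.trans_le hμ
  obtain ⟨K, M, N₀, hconv⟩ :=
    hsol.exists_convergence_bound hγ₀ hγ₁ hδ hb hd ha hc hμ0
  have huniq := fun (N : ℕ) (ζN uN ζN' uN' : ℝ → ℝ → ℝ)
      (h : IsSemidiscrete p T N ζ₀ u₀ ζN uN) (h' : IsSemidiscrete p T N ζ₀ u₀ ζN' uN')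
      (t : ℝ) (ht : t ∈ Icc 0 T) => h.unique hγ₀ hγ₁ hδ hb hd ha hc h' ht
  -- For N < N₀ existence is not guaranteed: if no solution exists any constant works, otherwise
  -- uniqueness transfers the bound of one solution to all.
  obtain ⟨C₁, hC₁⟩ := exists_uniform_bound
    (P := fun N C => 1 ≤ N → ∀ ζN uN : ℝ → ℝ → ℝ, IsSemidiscrete p T N ζ₀ u₀ ζN uN →
      ∀ t ∈ Icc 0 T, l2Norm (fun x => ζN t x - ζ t x) + l2Norm (fun x => uN t x - u t x) ≤
        C * (N : ℝ) ^ (-μ))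
    (fun N => by
      by_cases hex : ∃ ζN uN : ℝ → ℝ → ℝ, IsSemidiscrete p T N ζ₀ u₀ ζN uN
      · obtain ⟨ζN', uN', h'⟩ := hex
        obtain ⟨B, hB⟩ := h'.exists_error_le hμ0.le hsol
        -- The factor N^μ offsets N^(-μ), leaving the crude bound B.
        refine ⟨B * (N : ℝ) ^ μ, fun hN ζN uN h t ht => ?_⟩
        have hN0 : (0 : ℝ) < N := by exact_mod_cast hN
        rw [mul_assoc, ← Real.rpow_add hN0, add_neg_cancel, Real.rpow_zero, mul_one]
        obtain ⟨e1, e2⟩ := huniq N ζN uN ζN' uN' h h' t ht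
        rw [e1, e2]
        exact hB t ht
      · exact ⟨0, fun _ ζN uN h => absurd ⟨ζN, uN, h⟩ hex⟩)
    (fun N C C' hCC h hN ζN uN hs t ht => (h hN ζN uN hs t ht).trans
      (mul_le_mul_of_nonneg_right hCC (by positivity))) N₀
  refine ⟨max C₁ (2 * √K), N₀, fun N hN => ⟨fun hNN => ?_, huniq N, fun ζN uN h t ht => ?_⟩⟩
  · refine exists_isSemidiscrete hb hd hT.le (M := M) ?_
    intro f ft g gt h1 h2 h3 h4 h5 h6 h7 t ht
    have := hconv N hN hNN f ft g gt h1 h2 h3 h4 h5 h6 h7 t ht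
    exact ⟨this.1, this.2.1⟩
  · have hr : 0 ≤ (N : ℝ) ^ (-μ) := by positivity
    rcases lt_or_ge N N₀ with hlt | hge
    · exact (hC₁ N hlt hN ζN uN h t ht).trans (mul_le_mul_of_nonneg_right (le_max_left _ _) hr)
    · obtain ⟨ζNt, uNt, h⟩ := h
      have hm := h.solvesModes hb hd
      -- A genuine semidiscrete solution satisfies the mode equations at every time, so the
      -- conditional requirement of `hconv` holds at once.
      obtain ⟨-, -, e1, e2⟩ := hconv N hN hge ζN ζNt uN uNt h.mem_ζ h.mem_u hm.deriv_left
        hm.deriv_right (fun k hk => h.fhat_init_ζ hk) (fun k hk => h.fhat_init_u hk)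
        (fun s hs _ _ => hm.modeEq s hs) t ht
      calc _ ≤ √K * (N : ℝ) ^ (-μ) + √K * (N : ℝ) ^ (-μ) :=
            add_le_add (l2Norm_le_of_l2sq_le hr e1) (l2Norm_le_of_l2sq_le hr e2)
        _ = 2 * √K * (N : ℝ) ^ (-μ) := by ring
        _ ≤ _ := mul_le_mul_of_nonneg_right (le_max_right _ _) hr
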